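/- Let $r\ge 1$, let $n_1,\dots,n_r$ be non-negative integers, put $n=n_1+\dots+n_r$ and $G=GL(n,\mathbb{C})$. For a partition $\alpha$ of $m$ let $\mathcal{O}_\alpha\subset\mathfrak{gl}(m,\mathbb{C})$ be the set of nilpotent matrices whose Jordan blocks have the parts of $\alpha$ as their sizes. Let $\alpha_i$ be a partition of $n_i$ for $1\le i\le r$, and let $\gamma$ be a partition of $n$. Regard $\prod_i\mathcal{O}_{\alpha_i}$ as a set of block-diagonal matrices in $\mathfrak{gl}(n,\mathbb{C})$ (the orbit of the Levi subgroup $GL(n_1)\times\dots\times GL(n_r)$), and let $\mathfrak{n}$ be the space of strictly block upper triangular matrices with block sizes $n_1,\dots,n_r$ in this order (the nilradical of the corresponding standard parabolic subalgebra). Then \[ \mathcal{O}_\gamma\subset G\cdot\Big(\prod_{i=1}^r\mathcal{O}_{\alpha_i}+\mathfrak{n}\Big) \quad\Longleftrightarrow\quad N^\gamma_{\alpha_1,\dots,\alpha_r}\neq 0, \] where $G\cdot S=\{gYg^{-1}: g\in G,\ Y\in S\}$ and \[ N^\gamma_{\alpha_1,\dots,\alpha_r}=\sum_{\beta_2,\dots,\beta_{r-1}}c^{\beta_2}_{\alpha_1,\alpha_2}\,c^{\beta_3}_{\beta_2,\alpha_3}\cdots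 c^{\gamma}_{\beta_{r-1},\alpha_r}, \] the sum being over all partitions $\beta_k$ of $n_1+\dots+n_k$ for $2\le k\le r-1$ (so that $N^\gamma_{\alpha_1,\alpha_2}=c^\gamma_{\alpha_1,\alpha_2}$ for $r=2$; for $r=1$, $N^\gamma_{\alpha_1}$ is $1$ if $\gamma=\alpha_1$ and $0$ otherwise). Here the Littlewood–Richardson coefficient $c^\gamma_{\alpha,\beta}$ is the number of semistandard tableaux of skew shape $\gamma/\alpha$ (rows weakly increasing, columns strictly increasing) and content $\beta$ in which every prefix of the word obtained by reading the rows from top to bottom, each from right to left, contains at least as many $i$'s as $(i+1)$'s for every $i\ge 1$; it is $0$ if $\alpha\not\subset\gamma$. -/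

import Mathlib

open scoped Pointwise

noncomputable section

/-! ### Partitions and Littlewood-Richardson coefficients -/

/-- The Young diagram of a partition: its rows, from the top, are the parts in weakly decreasing
order.  Rows and columns are numbered from `0`; the cell `(i, j)` is in row `i`, column `j`. -/
def Nat.Partition.toYoungDiagram {n : ℕ} (p : n.Partition) : YoungDiagram :=
  YoungDiagram.ofRowLens (p.parts.sort (· ≥ ·)) (p.parts.pairwise_sort (· ≥ ·)).sortedGE

/-- The cells of the skew diagram `γ / α`. -/
def skewCells (α γ : YoungDiagram) : Finset (ℕ × ℕ) := γ.cells \ α.cells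

/-- `ReadBefore c d`: when a tableau is read by rows from top to bottom and, inside each row, from
right to left, the cell `c` is read before the cell `d`, or `c = d`. -/
def ReadBefore (c d : ℕ × ℕ) : Prop := c.1 < d.1 ∨ (c.1 = d.1 ∧ d.2 ≤ c.2)

instance (c d : ℕ × ℕ) : Decidable (ReadBefore c d) := by unfold ReadBefore; infer_instance

/-- Littlewood-Richardson tableaux of type `(α, β; γ)`: semistandard fillings of the skew diagram
`γ / α` with entries `1, 2, 3, …` and content `β` whose reverse reading word is a lattice word. -/
@[ext]
structure LRTableau (α β γ : YoungDiagram) where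
  /-- The entry in each cell, with the value `0` off the skew diagram. -/
  entry : ℕ × ℕ → ℕ
  /-- The inner diagram is contained in the outer one. -/
  le : α ≤ γ
  zero_off : ∀ c, c ∉ skewCells α γ → entry c = 0
  pos : ∀ c ∈ skewCells α γ, 1 ≤ entry c
  /-- Entries weakly increase along rows, from left to right. -/
  row_weak : ∀ i j j', (i, j) ∈ skewCells α γ → (i, j') ∈ skewCells α γ → j < j' →
    entry (i, j) ≤ entry (i, j')
  /-- Entries strictly increase down columns. -/
  col_strict : ∀ i i' j, (i, j) ∈ skewCells α γ → (i', j) ∈ skewCells α γ → i < i' →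
    entry (i, j) < entry (i', j)
  /-- The entry `m + 1` occurs as many times as row `m` of `β` (counted from `0`) has cells. -/
  content : ∀ m, ((skewCells α γ).filter (fun c => entry c = m + 1)).card = β.rowLen m
  /-- The Yamanouchi condition: in each prefix of the reading word (the prefix ending at the cell
  `d`), each `m ≥ 1` occurs at least as many times as `m + 1`. -/
  yamanouchi : ∀ d ∈ skewCells α γ, ∀ m, 1 ≤ m →
    ((skewCells α γ).filter (fun c => ReadBefore c d ∧ entry c = m + 1)).card ≤
      ((skewCells α γ).filter (fun c => ReadBefore c d ∧ entry c = m)).card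

/-- There are only finitely many Littlewood-Richardson tableaux of a given type. -/
instance (α β γ : YoungDiagram) : Finite (LRTableau α β γ) := by
  have hb : ∀ (T : LRTableau α β γ) (c : ℕ × ℕ), T.entry c < β.colLen 0 + 1 := by
    intro T c
    by_cases hc : c ∈ skewCells α γ
    · obtain ⟨m, hm⟩ : ∃ m, T.entry c = m + 1 := ⟨T.entry c - 1, by have := T.pos c hc; omega⟩
      have h1 : 0 < ((skewCells α γ).filter (fun c => T.entry c = m + 1)).card :=
        Finset.card_pos.mpr ⟨c, by simp [hc, hm]⟩
      rw [T.content m, ← YoungDiagram.mem_iff_lt_rowLen, YoungDiagram.mem_iff_lt_colLen] at h1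
      omega
    · rw [T.zero_off c hc]; omega
  refine Finite.of_injective
    (fun (T : LRTableau α β γ) (c : skewCells α γ) =>
      (⟨T.entry c, hb T c⟩ : Fin (β.colLen 0 + 1))) ?_
  intro T T' h
  ext c
  by_cases hc : c ∈ skewCells α γ
  · have := congrFun h ⟨c, hc⟩
    simpa using this
  · rw [T.zero_off c hc, T'.zero_off c hc]

/-- The Littlewood-Richardson coefficient `c_{α,β}^γ`: the number of Littlewood-Richardson tableaux
of type `(α, β; γ)`. -/
def lrCoeff {a b m : ℕ} (α : a.Partition) (β : b.Partition) (γ : m.Partition) : ℕ :=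
  Nat.card (LRTableau α.toYoungDiagram β.toYoungDiagram γ.toYoungDiagram)

/-- The number `N^γ_{α₀,…,α_r} = ∑ c_{β₀,α₁}^{β₁} c_{β₁,α₂}^{β₂} ⋯ c_{β_{r-1},α_r}^{β_r}`.
The sum is over all families of partitions `β_k` of `n₀ + ⋯ + n_k`, for `0 ≤ k ≤ r`, with the fixed
ends `β₀ = α₀` and `β_r = γ` (compared through their multisets of parts). -/
def iteratedLR {r : ℕ} (n : Fin (r + 1) → ℕ) (α : ∀ i, (n i).Partition)
    (γ : (∑ i, n i).Partition) : ℕ :=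
  ∑ β : (∀ k : Fin (r + 1), (∑ i ∈ Finset.Iic k, n i).Partition) with
      (β 0).parts = (α 0).parts ∧ (β (Fin.last r)).parts = γ.parts,
    ∏ k : Fin r, lrCoeff (β k.castSucc) (α k.succ) (β k.succ)

/-! ### Nilpotent orbits and standard parabolic subalgebras -/

/-- The nilpotent Jordan matrix whose blocks are the rows of `μ`; its basis vectors are the cells
of `μ`, and it sends the vector of `(i, j + 1)` to that of `(i, j)` and the vector of `(i, 0)`
to `0`. -/
def jordanMatrix (μ : YoungDiagram) : Matrix μ.cells μ.cells ℂ :=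
  fun c d => if d.1.1 = c.1.1 ∧ d.1.2 = c.1.2 + 1 then 1 else 0

/-- `G · S`, the union of the adjoint orbits under `G = GL(N, ℂ)` of the elements of `S`. -/
def adjointSaturation {N : ℕ} (S : Set (Matrix (Fin N) (Fin N) ℂ)) :
    Set (Matrix (Fin N) (Fin N) ℂ) :=
  {X | ∃ g : GL (Fin N) ℂ, ∃ Y ∈ S,
    X = (g : Matrix (Fin N) (Fin N) ℂ) * Y * ((g⁻¹ : GL (Fin N) ℂ) : Matrix (Fin N) (Fin N) ℂ)}

/-- The nilpotent orbit `O_α` in `gl(N, ℂ)`: the matrices conjugate to the Jordan matrix with blocks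
the parts of `α`, its basis being numbered in any way (which does not affect the orbit). -/
def nilpotentOrbit {N : ℕ} (α : N.Partition) : Set (Matrix (Fin N) (Fin N) ℂ) :=
  adjointSaturation
    {Y | ∃ e : Fin N ≃ α.toYoungDiagram.cells, Y = (jordanMatrix α.toYoungDiagram).submatrix e e}

/-- The orbit `∏ O_{α_i}` of the Levi subgroup `∏ GL(n_i)` of `GL(∑ n_i)`, embedded as block
diagonal matrices, with the blocks in the given order. -/
def leviOrbit {s : ℕ} (n : Fin s → ℕ) (α : ∀ i, (n i).Partition) :
    Set (Matrix (Fin (∑ i, n i)) (Fin (∑ i, n i)) ℂ) :=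
  {X | ∃ A : ∀ i, Matrix (Fin (n i)) (Fin (n i)) ℂ, (∀ i, A i ∈ nilpotentOrbit (α i)) ∧
    X = Matrix.reindex finSigmaFinEquiv finSigmaFinEquiv (Matrix.blockDiagonal' A)}

/-- The nilradical `𝔫` of the standard parabolic subalgebra of `gl(∑ n_i)` with block sizes `n_i`:
the strictly block upper triangular matrices. -/
def parabolicNilradical {s : ℕ} (n : Fin s → ℕ) :
    Submodule ℂ (Matrix (Fin (∑ i, n i)) (Fin (∑ i, n i)) ℂ) where
  carrier := {Y | ∀ (i j : Fin s) (a : Fin (n i)) (b : Fin (n j)), j ≤ i →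
    Y (finSigmaFinEquiv ⟨i, a⟩) (finSigmaFinEquiv ⟨j, b⟩) = 0}
  add_mem' hX hY i j a b h := by simp [hX i j a b h, hY i j a b h]
  zero_mem' i j a b h := rfl
  smul_mem' c X hX i j a b h := by simp [hX i j a b h]

end

/-!
A nilpotent matrix makes `ℂ ^ N` into a `ℂ[X]`-module on which `X` is nilpotent, and its Jordan type
is the type of that module (`mem_nilpotentOrbit_iff`). A matrix is conjugate to an element of
`∏ O_{α_i} + 𝔫` if and only if its module has a flag of submodules whose successive quotients have the
types `α_i` (`mem_adjointSaturation_leviOrbit_iff`). Going through the types of the members of such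
a flag, everything reduces to one step: a module of type `γ` has a submodule of type `α` with
quotient of type `β` if and only if `c_{α,β}^γ ≠ 0`.

A Littlewood-Richardson tableau is encoded as a chain of partitions `α = l 0 ⊆ l 1 ⊆ ⋯ ⊆ γ`, where
`l i` is the shape filled by the entries up to `i` (`LRChain`, `nonempty_lrTableau_iff`).

From a chain to a submodule (`LRChain.exists_submodule`). Start from the standard generators `y_n`
of a module of type `γ` and put `y_{i-1} = B_i y_i`, where `B_i` is the bidiagonal matrix with
entries `X ^ (l_{i,r} - l_{i-1,r})` on the diagonal and `-1` above it. Let `N_i` be the submodule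
generated by the entries of `y_i`. The horizontal strip condition gives
`X ^ l_{i,r} • y_{i,r} = 0`, the quotients `N_i / N_{i-1}` are cyclic of length at most `β_i`, and the lattice condition
makes it possible to correct their generators so that they are annihilated by `X ^ β_i` modulo
`N_0`. A count of dimensions then shows that `N_0` has type `α` and that the quotient by `N_0` has
type `β`.

From a submodule to a chain (`exists_lrChain_of_hasType`). For a submodule `N` of `M`, let `m i j`
be the largest dimension of a submodule generated by `i` elements of `M` and `j` elements of `N`
(`genDim`). As the base field is infinite, all these maxima are attained by the same generic
vectors (`exists_generic`). The values of `m` on the three sides of its domain are partial sums of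
the types of `N`, of `M` and of `M / N`, because a submodule with `k` generators of a module of type
`μ` has at most the dimension of the `k` largest summands (`HasType.finrank_spanLT_le`). Finally,
`m` satisfies the three rhombus inequalities of a hive: one is the submodularity of the dimension
(`genDim_modular`), the two others (`genDim_upper`, `genDim_lower`) come from the fact that cyclic
nilpotent modules are uniserial (`finrank_add_le_of_generic`). A hive with such boundary values is
a Littlewood-Richardson chain (`exists_lrChain_of_rhombus`).
-/

/-! ### Littlewood-Richardson tableaux as chains of partitions -/

/-- A Littlewood-Richardson chain of type `(α, β; γ)`: the tableau is recorded by the numbers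
`l i r` of cells in row `r` of `γ`, those of `α` included, whose entry is at most `i` (the cells of
`α` having entry `0`).  Every condition is written without subtraction, through the partial sums
`∑ r < R, l i r`. -/
structure LRChain (α β γ : YoungDiagram) (l : ℕ → ℕ → ℕ) : Prop where
  zero : ∀ r, l 0 r = α.rowLen r
  mono : ∀ i r, l i r ≤ l (i + 1) r
  eventually : ∃ N, ∀ i, N ≤ i → ∀ r, l i r = γ.rowLen r
  /-- Consecutive partitions differ by a horizontal strip. -/
  strip : ∀ i r, l (i + 1) (r + 1) ≤ l i r
  /-- The `i`-th strip has `β_i` cells. -/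
  content : ∀ i, ∃ N, ∀ R, N ≤ R →
    ∑ r ∈ Finset.range R, l (i + 1) r = ∑ r ∈ Finset.range R, l i r + β.rowLen i
  /-- The entries `i + 2` in the rows up to `R` are at most as many as the entries `i + 1` in the
  rows before `R`. -/
  lattice : ∀ i R,
    ∑ r ∈ Finset.range (R + 1), l (i + 2) r + ∑ r ∈ Finset.range R, l i r ≤
      ∑ r ∈ Finset.range R, l (i + 1) r + ∑ r ∈ Finset.range (R + 1), l (i + 1) r

theorem Finset.mem_iff_lt_card_of_isLowerSet {S : Finset ℕ} (hS : IsLowerSet (S : Set ℕ)) (c : ℕ) :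
    c ∈ S ↔ c < S.card := by
  constructor
  · intro hc
    have : Finset.range (c + 1) ⊆ S := fun d hd => hS (by simp at hd; omega) hc
    simpa using Finset.card_le_card this
  · intro hc
    by_contra h
    have : S ⊆ Finset.range c := fun d hd => by
      rw [Finset.mem_range]
      by_contra hcd
      exact h (hS (not_lt.mp hcd) hd)
    have := Finset.card_le_card this
    simp at this
    omega

/-- The number of cells between two compositions in the rows before `R`. -/
theorem card_band_add_sum {a b : ℕ → ℕ} (hab : ∀ r, a r ≤ b r) {R : ℕ} {F : Finset (ℕ × ℕ)}
    (hF : ∀ r c, (r, c) ∈ F ↔ r < R ∧ a r ≤ c ∧ c < b r) :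
    F.card + ∑ r ∈ Finset.range R, a r = ∑ r ∈ Finset.range R, b r := by
  have h1 : F.card = ∑ r ∈ Finset.range R, (b r - a r) := by
    rw [Finset.card_eq_sum_card_fiberwise (f := Prod.fst) (t := Finset.range R)]
    · refine Finset.sum_congr rfl fun r hr => ?_
      have : F.filter (fun c => c.1 = r) = (Finset.Ico (a r) (b r)).map
          ⟨fun c => (r, c), fun _ _ h => (Prod.ext_iff.mp h).2⟩ := by
        ext ⟨x, y⟩
        simp only [Finset.mem_filter, hF, Finset.mem_map, Finset.mem_Ico]
        rw [Finset.mem_range] at hr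
        constructor
        · rintro ⟨⟨h1, h2, h3⟩, rfl⟩
          exact ⟨y, ⟨h2, h3⟩, rfl⟩
        · rintro ⟨z, ⟨h2, h3⟩, hz⟩
          obtain ⟨rfl, rfl⟩ := Prod.ext_iff.mp hz
          exact ⟨⟨hr, h2, h3⟩, rfl⟩
      rw [this, Finset.card_map, Nat.card_Ico]
    · rintro ⟨x, y⟩ h
      simpa using ((hF x y).mp h).1
  rw [h1, ← Finset.sum_add_distrib]
  exact Finset.sum_congr rfl fun r _ => Nat.sub_add_cancel (hab r)

theorem mem_skewCells {α γ : YoungDiagram} {r c : ℕ} :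
    (r, c) ∈ skewCells α γ ↔ α.rowLen r ≤ c ∧ c < γ.rowLen r := by
  simp only [skewCells, Finset.mem_sdiff, YoungDiagram.mem_cells, YoungDiagram.mem_iff_lt_rowLen]
  omega

theorem YoungDiagram.rowLen_eq_zero_of_card_le (μ : YoungDiagram) {r : ℕ} (hr : μ.card ≤ r) :
    μ.rowLen r = 0 := by
  by_contra h
  have h1 : (r, 0) ∈ μ := YoungDiagram.mem_iff_lt_rowLen.mpr (Nat.pos_of_ne_zero h)
  have h2 : (Finset.range (r + 1)).map ⟨fun i => (i, 0), fun _ _ h => (Prod.ext_iff.mp h).1⟩ ⊆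
      μ.cells := by
    intro x hx
    simp only [Finset.mem_map, Finset.mem_range] at hx
    obtain ⟨i, hi, rfl⟩ := hx
    exact μ.up_left_mem (by omega) le_rfl h1
  have := Finset.card_le_card h2
  rw [Finset.card_map, Finset.card_range] at this
  change r + 1 ≤ μ.card at this
  omega

theorem YoungDiagram.sum_rowLen (μ : YoungDiagram) {R : ℕ} (hR : ∀ r, R ≤ r → μ.rowLen r = 0) :
    ∑ r ∈ Finset.range R, μ.rowLen r = μ.card := by
  have := card_band_add_sum (a := fun _ => 0) (b := μ.rowLen) (fun _ => Nat.zero_le _) (R := R)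
    (F := μ.cells) (fun r c => by
      rw [YoungDiagram.mem_cells, YoungDiagram.mem_iff_lt_rowLen]
      refine ⟨fun h => ⟨?_, Nat.zero_le _, h⟩, fun h => h.2.2⟩
      by_contra hr
      rw [hR r (not_lt.mp hr)] at h
      omega)
  simpa using this.symm

theorem YoungDiagram.ext_rowLen {μ ν : YoungDiagram} (h : ∀ r, μ.rowLen r = ν.rowLen r) :
    μ = ν := by
  ext ⟨i, j⟩
  simp [YoungDiagram.mem_iff_lt_rowLen, h i]

namespace LRTableau

variable {α β γ : YoungDiagram} (T : LRTableau α β γ)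

/-- The number of cells of row `r` of `γ` whose entry is at most `i`. -/
def rowCount (i r : ℕ) : ℕ :=
  ((Finset.range (γ.rowLen r)).filter (fun c => T.entry (r, c) ≤ i)).card

theorem rowLen_le (T : LRTableau α β γ) (r : ℕ) : α.rowLen r ≤ γ.rowLen r := by
  by_contra! h
  have := T.le (YoungDiagram.mem_iff_lt_rowLen.mpr h)
  rw [YoungDiagram.mem_iff_lt_rowLen] at this
  omega

theorem entry_mono {r c d : ℕ} (hcd : c ≤ d) (hd : d < γ.rowLen r) :
    T.entry (r, c) ≤ T.entry (r, d) := by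
  rcases hcd.eq_or_lt with rfl | hcd
  · exact le_rfl
  by_cases hc : (r, c) ∈ skewCells α γ
  · have hc' := mem_skewCells.mp hc
    exact T.row_weak r c d hc (mem_skewCells.mpr ⟨by omega, hd⟩) hcd
  · rw [T.zero_off _ hc]; exact Nat.zero_le _

theorem entry_le_iff {i r c : ℕ} (hc : c < γ.rowLen r) :
    T.entry (r, c) ≤ i ↔ c < T.rowCount i r := by
  rw [rowCount, ← Finset.mem_iff_lt_card_of_isLowerSet]
  · simp [hc]
  · intro d c hcd hd
    simp only [Finset.coe_filter, Finset.mem_range, Set.mem_ofPred_eq] at hd ⊢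
    exact ⟨hcd.trans_lt hd.1, (T.entry_mono hcd hd.1).trans hd.2⟩

theorem rowCount_le (i r : ℕ) : T.rowCount i r ≤ γ.rowLen r :=
  (Finset.card_filter_le _ _).trans (by simp)

theorem rowCount_mono {i j : ℕ} (hij : i ≤ j) (r : ℕ) : T.rowCount i r ≤ T.rowCount j r :=
  Finset.card_le_card fun c hc => by
    simp only [Finset.mem_filter] at hc ⊢
    exact ⟨hc.1, hc.2.trans hij⟩

theorem mem_and_entry_iff {m r c : ℕ} :
    (r, c) ∈ skewCells α γ ∧ T.entry (r, c) = m + 1 ↔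
      T.rowCount m r ≤ c ∧ c < T.rowCount (m + 1) r := by
  by_cases hc : c < γ.rowLen r
  · have h1 := T.entry_le_iff (i := m) hc
    have h2 := T.entry_le_iff (i := m + 1) hc
    constructor
    · rintro ⟨_, h⟩
      omega
    · rintro ⟨h3, h4⟩
      refine ⟨?_, by omega⟩
      by_contra hn
      have := T.zero_off _ hn
      omega
  · constructor
    · rintro ⟨h, _⟩
      exact absurd (mem_skewCells.mp h).2 hc
    · rintro ⟨_, h⟩
      exact absurd (h.trans_le (T.rowCount_le _ _)) hc

theorem rowCount_zero (r : ℕ) : T.rowCount 0 r = α.rowLen r := by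
  have key : ∀ c, c < T.rowCount 0 r ↔ c < α.rowLen r := by
    intro c
    by_cases hc : c < γ.rowLen r
    · rw [← T.entry_le_iff hc]
      constructor
      · intro h
        by_contra hn
        have := T.pos (r, c) (mem_skewCells.mpr ⟨not_lt.mp hn, hc⟩)
        omega
      · intro h
        rw [T.zero_off]
        rw [mem_skewCells]
        omega
    · have := T.rowCount_le 0 r
      have := T.rowLen_le r
      omega
  exact le_antisymm (not_lt.mp fun h => absurd ((key _).mp h) (lt_irrefl _))
    (not_lt.mp fun h => absurd ((key _).mpr h) (lt_irrefl _))

/-- The entries `m + 1` in the rows before `R`, counted through `rowCount`. -/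
theorem card_entry_add_sum (m R : ℕ) :
    ((skewCells α γ).filter (fun c => c.1 < R ∧ T.entry c = m + 1)).card +
      ∑ r ∈ Finset.range R, T.rowCount m r = ∑ r ∈ Finset.range R, T.rowCount (m + 1) r := by
  refine card_band_add_sum (fun r => T.rowCount_mono (Nat.le_succ m) r) fun r c => ?_
  rw [← T.mem_and_entry_iff, Finset.mem_filter]
  tauto

/-- The lattice condition by rows: the prefix of the reading word that ends at the leftmost entry
`m + 2` of a row contains no entry `m + 1` of that row, so the entries `m + 2` in the rows up to `R`
are preceded by as many entries `m + 1` in the rows before `R`. -/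
theorem card_entry_succ_le (m R : ℕ) :
    ((skewCells α γ).filter (fun c => c.1 < R + 1 ∧ T.entry c = m + 2)).card ≤
      ((skewCells α γ).filter (fun c => c.1 < R ∧ T.entry c = m + 1)).card := by
  induction R with
  | zero =>
    rw [Finset.card_eq_zero.mpr, Finset.card_eq_zero.mpr] <;> try simp
    -- an entry `m + 2` in row `0` would be preceded by an entry `m + 1`, on its right
    intro r c h hr he
    obtain rfl : r = 0 := by omega
    have hy := T.yamanouchi _ h (m + 1) (by omega)
    have h1 : 0 < ((skewCells α γ).filter
        (fun d => ReadBefore d (0, c) ∧ T.entry d = m + 1 + 1)).card :=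
      Finset.card_pos.mpr ⟨(0, c), by simp [h, he, ReadBefore]⟩
    obtain ⟨⟨x, y⟩, hxy⟩ := Finset.card_pos.mp (h1.trans_le hy)
    rw [Finset.mem_filter] at hxy
    unfold ReadBefore at hxy
    obtain ⟨h2, h3, h4⟩ := hxy
    obtain ⟨rfl, h5⟩ : x = 0 ∧ c ≤ y := by omega
    have := T.entry_mono h5 (mem_skewCells.mp h2).2
    omega
  | succ R ih =>
    by_cases hex : ∃ c, (R + 1, c) ∈ skewCells α γ ∧ T.entry (R + 1, c) = m + 2
    · have h0 := Nat.find_spec hex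
      have hmin : ∀ c', _ → _ → Nat.find hex ≤ c' := fun c' h h' => Nat.find_min' hex ⟨h, h'⟩
      set c := Nat.find hex
      refine le_trans (Finset.card_le_card ?_)
        ((T.yamanouchi _ h0.1 (m + 1) (by omega)).trans (Finset.card_le_card ?_))
      · rintro ⟨x, y⟩ h
        rw [Finset.mem_filter] at h ⊢
        unfold ReadBefore at *
        refine ⟨h.1, ?_, h.2.2⟩
        by_cases hx : x < R + 1
        · exact Or.inl hx
        · obtain rfl : x = R + 1 := by omega
          exact Or.inr ⟨rfl, hmin y h.1 h.2.2⟩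
      · rintro ⟨x, y⟩ h
        rw [Finset.mem_filter] at h ⊢
        unfold ReadBefore at *
        obtain ⟨h1, h2, h3⟩ := h
        refine ⟨h1, ?_, h3⟩
        rcases h2 with h2 | ⟨rfl, h2⟩
        · exact h2
        · have : T.entry (R + 1, c) ≤ T.entry (R + 1, y) :=
            T.entry_mono h2 (mem_skewCells.mp h1).2
          rw [h0.2, h3] at this
          omega
    · refine le_trans (Finset.card_le_card ?_) (ih.trans (Finset.card_le_card ?_))
      · rintro ⟨x, y⟩ h
        simp only [Finset.mem_filter] at h ⊢
        refine ⟨h.1, ?_, h.2.2⟩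
        by_contra hx
        obtain rfl : x = R + 1 := by omega
        exact hex ⟨y, h.1, h.2.2⟩
      · intro x h
        simp only [Finset.mem_filter] at h ⊢
        exact ⟨h.1, by omega, h.2.2⟩

theorem lrChain : LRChain α β γ T.rowCount where
  zero := T.rowCount_zero
  mono i r := T.rowCount_mono (Nat.le_succ i) r
  eventually := by
    refine ⟨(skewCells α γ).sup T.entry, fun i hi r => ?_⟩
    rw [rowCount, Finset.filter_true_of_mem, Finset.card_range]
    intro c _
    by_cases hc : (r, c) ∈ skewCells α γ
    · exact (Finset.le_sup (f := T.entry) hc).trans hi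
    · rw [T.zero_off _ hc]; exact Nat.zero_le _
  strip i r := by
    by_contra! h
    have h1 : T.rowCount i r < γ.rowLen (r + 1) := h.trans_le (T.rowCount_le _ _)
    have h2 : γ.rowLen (r + 1) ≤ γ.rowLen r := γ.rowLen_anti _ _ (Nat.le_succ r)
    have h3 := (T.entry_le_iff h1).mpr h
    have h4 := (T.entry_le_iff (i := i) (h1.trans_le h2)).not.mpr (lt_irrefl _)
    have h5 : (r, T.rowCount i r) ∈ skewCells α γ := by
      by_contra hn
      rw [T.zero_off _ hn] at h4
      omega
    have h6 : (r + 1, T.rowCount i r) ∈ skewCells α γ := mem_skewCells.mpr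
      ⟨(α.rowLen_anti _ _ (Nat.le_succ r)).trans (mem_skewCells.mp h5).1, h1⟩
    have := T.col_strict _ _ _ h5 h6 (Nat.lt_succ_self r)
    omega
  content i := by
    refine ⟨γ.card, fun R hR => ?_⟩
    rw [← T.card_entry_add_sum i R, ← T.content i, add_comm]
    congr 2
    refine Finset.filter_congr ?_
    rintro ⟨r, c⟩ h
    refine and_iff_right ?_
    by_contra hr
    have h0 : γ.rowLen r = 0 := γ.rowLen_eq_zero_of_card_le (hR.trans (not_lt.mp hr))
    have := (mem_skewCells.mp h).2
    omega
  lattice i R := by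
    have h1 := T.card_entry_add_sum (i + 1) (R + 1)
    have h2 := T.card_entry_add_sum i R
    have h3 := T.card_entry_succ_le i R
    simp only [add_assoc, Nat.reduceAdd] at h1
    omega

end LRTableau

namespace LRChain

variable {α β γ : YoungDiagram} {l : ℕ → ℕ → ℕ}


theorem mono_le (h : LRChain α β γ l) {i j : ℕ} (hij : i ≤ j) (r : ℕ) : l i r ≤ l j r :=
  monotone_nat_of_le_succ (f := fun i => l i r) (fun i => h.mono i r) hij

theorem le_rowLen (h : LRChain α β γ l) (i r : ℕ) : l i r ≤ γ.rowLen r := by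
  obtain ⟨N, hN⟩ := h.eventually
  exact (h.mono_le (le_max_left i N) r).trans (hN _ (le_max_right i N) r).le

theorem exists_lt (h : LRChain α β γ l) {r c : ℕ} (hc : c < γ.rowLen r) : ∃ i, c < l i r := by
  obtain ⟨N, hN⟩ := h.eventually
  exact ⟨N, by rw [hN N le_rfl]; exact hc⟩

/-- The filling recorded by a chain: the cell `(r, c)` contains the least `i` with `c < l i r`. -/
theorem exists_entry (h : LRChain α β γ l) : ∃ e : ℕ × ℕ → ℕ, (∀ c, c ∉ skewCells α γ → e c = 0) ∧
    ∀ r c, (r, c) ∈ skewCells α γ → ∀ i, e (r, c) ≤ i ↔ c < l i r := by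
  classical
  refine ⟨fun c => if hc : c.2 < γ.rowLen c.1 then Nat.find (h.exists_lt hc) else 0, ?_, ?_⟩
  · rintro ⟨r, c⟩ hc
    rw [mem_skewCells] at hc
    dsimp only
    split_ifs with h1
    · rw [Nat.find_eq_zero, h.zero]
      omega
    · rfl
  · intro r c hc i
    dsimp only
    rw [dif_pos (mem_skewCells.mp hc).2, Nat.find_le_iff]
    exact ⟨fun ⟨m, hm, h1⟩ => h1.trans_le (h.mono_le hm r), fun h1 => ⟨i, le_rfl, h1⟩⟩

theorem nonempty_lrTableau (h : LRChain α β γ l) : Nonempty (LRTableau α β γ) := by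
  obtain ⟨e, he0, he⟩ := h.exists_entry
  have hband : ∀ m r c, (r, c) ∈ skewCells α γ ∧ e (r, c) = m + 1 ↔
      l m r ≤ c ∧ c < l (m + 1) r := by
    intro m r c
    constructor
    · rintro ⟨h1, h2⟩
      have := he r c h1 m
      have := he r c h1 (m + 1)
      omega
    · rintro ⟨h1, h2⟩
      have h3 : (r, c) ∈ skewCells α γ := mem_skewCells.mpr
        ⟨(h.zero r).symm.le.trans ((h.mono_le (Nat.zero_le m) r).trans h1),
          h2.trans_le (h.le_rowLen _ r)⟩
      have := he r c h3 m
      have := he r c h3 (m + 1)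
      exact ⟨h3, by omega⟩
  have hcard : ∀ m R, ((skewCells α γ).filter (fun c => c.1 < R ∧ e c = m + 1)).card +
      ∑ r ∈ Finset.range R, l m r = ∑ r ∈ Finset.range R, l (m + 1) r := by
    intro m R
    refine card_band_add_sum (fun r => h.mono m r) fun r c => ?_
    rw [← hband, Finset.mem_filter]
    tauto
  have hpos : ∀ c ∈ skewCells α γ, 1 ≤ e c := by
    rintro ⟨r, c⟩ hc
    have h1 := he r c hc 0
    have h2 := (mem_skewCells.mp hc).1
    rw [h.zero] at h1
    omega
  refine ⟨⟨e, ?_, he0, hpos, ?_, ?_, ?_, ?_⟩⟩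
  · rintro ⟨r, c⟩ hc
    rw [YoungDiagram.mem_iff_lt_rowLen, ← h.zero] at hc
    rw [YoungDiagram.mem_iff_lt_rowLen]
    exact hc.trans_le (h.le_rowLen 0 r)
  · intro r c d hc hd hcd
    rw [he r c hc]
    exact hcd.trans ((he r d hd _).mp le_rfl)
  · intro r s c hr hs hrs
    -- going down from row `r` to row `s`, each step lowers the index by at least one
    have hstep : ∀ k i, l (i + k) (r + k) ≤ l i r := by
      intro k
      induction k with
      | zero => exact fun i => le_rfl
      | succ k ih => exact fun i => (h.strip _ _).trans (ih i)
    have h1 := (he s c hs _).mp le_rfl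
    have h2 := hpos _ hs
    obtain ⟨k, rfl⟩ : ∃ k, s = r + (k + 1) := ⟨s - r - 1, by omega⟩
    by_contra hlt
    have h3 := (he r c hr (e (r + (k + 1), c) - 1)).not.mp (by omega)
    refine h3 ?_
    calc c < l (e (r + (k + 1), c)) (r + (k + 1)) := h1
      _ ≤ l (e (r + (k + 1), c) - 1 + (k + 1)) (r + (k + 1)) := h.mono_le (by omega) _
      _ ≤ _ := hstep _ _
  · intro m
    obtain ⟨N, hN⟩ := h.content m
    have h1 := hN (max N γ.card) (le_max_left _ _)
    have h2 := hcard m (max N γ.card)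
    have h3 : ((skewCells α γ).filter (fun c => c.1 < max N γ.card ∧ e c = m + 1)) =
        ((skewCells α γ).filter (fun c => e c = m + 1)) := by
      refine Finset.filter_congr ?_
      rintro ⟨r, c⟩ hc
      refine and_iff_right ?_
      by_contra hr
      have h0 : γ.rowLen r = 0 :=
        γ.rowLen_eq_zero_of_card_le ((le_max_right _ _).trans (not_lt.mp hr))
      have := (mem_skewCells.mp hc).2
      omega
    rw [h3] at h2
    omega
  · rintro ⟨r, c⟩ _ m hm
    obtain ⟨m, rfl⟩ : ∃ k, m = k + 1 := ⟨m - 1, by omega⟩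
    -- all entries `m + 1` of the rows before `r` are in the prefix
    have h1 : ((skewCells α γ).filter (fun d => ReadBefore d (r, c) ∧ e d = m + 1 + 1)).card ≤
        ((skewCells α γ).filter (fun d => d.1 < r + 1 ∧ e d = m + 1 + 1)).card := by
      refine Finset.card_le_card fun d hd => ?_
      rw [Finset.mem_filter] at hd ⊢
      unfold ReadBefore at *
      exact ⟨hd.1, by omega, hd.2.2⟩
    have h2 : ((skewCells α γ).filter (fun d => d.1 < r ∧ e d = m + 1)).card ≤
        ((skewCells α γ).filter (fun d => ReadBefore d (r, c) ∧ e d = m + 1)).card := by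
      refine Finset.card_le_card fun d hd => ?_
      rw [Finset.mem_filter] at hd ⊢
      unfold ReadBefore at *
      exact ⟨hd.1, Or.inl hd.2.1, hd.2.2⟩
    have h3 := hcard (m + 1) (r + 1)
    have h4 := hcard m r
    have h5 := h.lattice m r
    have h6 : m + 1 + 1 = m + 2 := rfl
    rw [h6] at h3 h1 ⊢
    omega

end LRChain

theorem nonempty_lrTableau_iff {α β γ : YoungDiagram} :
    Nonempty (LRTableau α β γ) ↔ ∃ l, LRChain α β γ l :=
  ⟨fun ⟨T⟩ => ⟨_, T.lrChain⟩, fun ⟨_, h⟩ => h.nonempty_lrTableau⟩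

/-! ### Polynomial modules of finite dimension -/

open Polynomial

section PolynomialModule

open Module (finrank)

variable {K M : Type*} [Field K] [AddCommGroup M] [Module K[X] M]

theorem mem_sup_span_singleton_iff {B : Submodule K[X] M} {x z : M} :
    z ∈ B ⊔ Submodule.span K[X] {x} ↔ ∃ b ∈ B, ∃ p : K[X], b + p • x = z := by
  simp only [Submodule.mem_sup, Submodule.mem_span_singleton, exists_exists_eq_and]

/-- Nakayama's lemma for one generator. -/
theorem mem_of_mem_sup_span_X_smul (hX : ∀ x : M, ∃ d, (X : K[X]) ^ d • x = 0)
    {B : Submodule K[X] M} {x : M} (hx : x ∈ B ⊔ Submodule.span K[X] {(X : K[X]) • x}) :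
    x ∈ B := by
  have key : ∀ n, x ∈ B ⊔ Submodule.span K[X] {(X : K[X]) ^ n • x} := by
    intro n
    induction n with
    | zero => exact Submodule.mem_sup_right (by simp [Submodule.mem_span_singleton_self])
    | succ n ih =>
      obtain ⟨b, hb, p, hp⟩ := mem_sup_span_singleton_iff.mp hx
      obtain ⟨c, hc, q, hq⟩ := mem_sup_span_singleton_iff.mp ih
      refine mem_sup_span_singleton_iff.mpr
        ⟨b + (p * X) • c, B.add_mem hb (B.smul_mem _ hc), p * q, ?_⟩
      calc b + (p * X) • c + (p * q) • (X : K[X]) ^ (n + 1) • x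
          = b + p • (X : K[X]) • (c + q • (X : K[X]) ^ n • x) := by
            simp only [smul_add, smul_smul, add_assoc]
            ring_nf
        _ = x := by rw [hq, hp]
  obtain ⟨d, hd⟩ := hX x
  simpa [hd] using key d

/-- The `K[X]`-submodule generated by the first `k` terms of a sequence. -/
noncomputable def spanLT (K : Type*) {M : Type*} [Field K] [AddCommGroup M] [Module K[X] M]
    (y : ℕ → M) (k : ℕ) :
    Submodule K[X] M :=
  Submodule.span K[X] (y '' Set.Iio k)

theorem spanLT_zero (y : ℕ → M) : spanLT K y 0 = ⊥ := by simp [spanLT]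

theorem spanLT_succ (y : ℕ → M) (k : ℕ) :
    spanLT K y (k + 1) = spanLT K y k ⊔ Submodule.span K[X] {y k} := by
  have : Set.Iio (k + 1) = Set.Iio k ∪ {k} := by ext; simp
  rw [spanLT, this, Set.image_union, Set.image_singleton, Submodule.span_union, spanLT]

theorem mem_spanLT (y : ℕ → M) {k i : ℕ} (h : i < k) : y i ∈ spanLT K y k :=
  Submodule.subset_span ⟨i, h, rfl⟩

theorem spanLT_le {y : ℕ → M} {k : ℕ} {N : Submodule K[X] M} (h : ∀ i, i < k → y i ∈ N) :
    spanLT K y k ≤ N := by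
  rw [spanLT, Submodule.span_le]
  rintro _ ⟨i, hi, rfl⟩
  exact h i hi

theorem spanLT_eq_top {μ : YoungDiagram} {x : ℕ → M}
    (hx : ∀ r, (X : K[X]) ^ μ.rowLen r • x r = 0)
    (hs : Submodule.span K[X] (Set.range x) = ⊤) {k : ℕ} (hk : ∀ r, k ≤ r → μ.rowLen r = 0) :
    spanLT K x k = ⊤ := by
  rw [eq_top_iff, ← hs, Submodule.span_le]
  rintro _ ⟨i, rfl⟩
  by_cases hi : i < k
  · exact mem_spanLT x hi
  · have := hx i
    rw [hk i (not_lt.mp hi), pow_zero, one_smul] at this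
    rw [this]
    exact Submodule.zero_mem _

/-- Multiplication by `X` as a `K[X]`-linear map. -/
noncomputable def smulX (K M : Type*) [Field K] [AddCommGroup M] [Module K[X] M] : M →ₗ[K[X]] M :=
  LinearMap.lsmul K[X] M X

theorem smulX_apply (z : M) : smulX K M z = (X : K[X]) • z := rfl

theorem spanLT_map_pow_smulX (y : ℕ → M) (k s : ℕ) :
    (spanLT K y k).map (smulX K M ^ s) = spanLT K (fun i => (X : K[X]) ^ s • y i) k := by
  rw [spanLT, Submodule.map_span, spanLT, Set.image_image]
  congr 1
  refine Set.image_congr fun i _ => ?_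
  induction s with
  | zero => simp
  | succ s ih => rw [pow_succ', Module.End.mul_apply, ih, smulX_apply, smul_smul, ← pow_succ']

variable [Module K M] [IsScalarTower K K[X] M]

instance Submodule.finiteDimensional_polynomialModule [FiniteDimensional K M]
    (N : Submodule K[X] M) : FiniteDimensional K N :=
  inferInstanceAs (FiniteDimensional K (N.restrictScalars K))

theorem finrank_polynomialModule_mono [FiniteDimensional K M] {N P : Submodule K[X] M}
    (h : N ≤ P) : finrank K N ≤ finrank K P :=
  Submodule.finrank_mono (s := N.restrictScalars K) (t := P.restrictScalars K) h

theorem eq_of_le_of_finrank_polynomialModule_le [FiniteDimensional K M] {N P : Submodule K[X] M}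
    (h : N ≤ P) (h' : finrank K P ≤ finrank K N) : N = P :=
  Submodule.restrictScalars_injective K K[X] M
    (Submodule.eq_of_le_of_finrank_le (S₁ := N.restrictScalars K) (S₂ := P.restrictScalars K) h h')

theorem finrank_sup_add_finrank_inf_polynomialModule [FiniteDimensional K M]
    (N P : Submodule K[X] M) :
    finrank K ↥(N ⊔ P) + finrank K ↥(N ⊓ P) = finrank K N + finrank K P := by
  have := Submodule.finrank_sup_add_finrank_inf_eq (N.restrictScalars K) (P.restrictScalars K)
  rw [← Submodule.restrictScalars_sup] at this
  exact this

theorem finrank_polynomialModule_top : finrank K (⊤ : Submodule K[X] M) = finrank K M :=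
  finrank_top K M

theorem finrank_polynomialModule_bot : finrank K (⊥ : Submodule K[X] M) = 0 :=
  finrank_bot K M

theorem finrank_quotient_add_finrank_polynomialModule [FiniteDimensional K M]
    (N : Submodule K[X] M) : finrank K (M ⧸ N) + finrank K N = finrank K M := by
  rw [← Submodule.finrank_quotient_add_finrank (N.restrictScalars K)]
  rfl

theorem finrank_sup_span_singleton_le [FiniteDimensional K M] (B : Submodule K[X] M) (x : M) :
    finrank K ↥(B ⊔ Submodule.span K[X] {x}) ≤
      finrank K ↥(B ⊔ Submodule.span K[X] {(X : K[X]) • x}) + 1 := by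
  set B' := B ⊔ Submodule.span K[X] {(X : K[X]) • x} with hB'
  have h1 : (B ⊔ Submodule.span K[X] {x}).restrictScalars K ≤
      B'.restrictScalars K ⊔ Submodule.span K {x} := by
    intro z hz
    rw [Submodule.restrictScalars_mem, mem_sup_span_singleton_iff] at hz
    obtain ⟨b, hb, p, rfl⟩ := hz
    rw [← Polynomial.divX_mul_X_add p, add_smul, ← add_assoc]
    refine Submodule.add_mem_sup ?_ ?_
    · rw [Submodule.restrictScalars_mem, hB', mem_sup_span_singleton_iff]
      exact ⟨b, hb, p.divX, by rw [mul_smul]⟩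
    · have : (C (p.coeff 0) : K[X]) • x = p.coeff 0 • x := by
        rw [← algebraMap_smul K[X] (p.coeff 0) x]; rfl
      rw [this]
      exact Submodule.smul_mem _ _ (Submodule.mem_span_singleton_self x)
  calc _ ≤ finrank K ↥(B'.restrictScalars K ⊔ Submodule.span K {x}) := Submodule.finrank_mono h1
    _ ≤ finrank K ↥(B'.restrictScalars K) + finrank K ↥(Submodule.span K {x}) :=
      Submodule.finrank_add_le_finrank_add_finrank _ _
    _ ≤ _ := Nat.add_le_add le_rfl ((finrank_span_le_card _).trans (by simp))

/-- The dimension added by a generator `x` is the least `e` with `X ^ e • x ∈ B`. -/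
theorem exists_order [FiniteDimensional K M] (hX : ∀ x : M, ∃ d, (X : K[X]) ^ d • x = 0)
    (B : Submodule K[X] M) (x : M) : ∃ e, (X : K[X]) ^ e • x ∈ B ∧
      (∀ d, (X : K[X]) ^ d • x ∈ B → e ≤ d) ∧
      finrank K ↥(B ⊔ Submodule.span K[X] {x}) = finrank K B + e := by
  classical
  have hex : ∃ e, (X : K[X]) ^ e • x ∈ B := by
    obtain ⟨d, hd⟩ := hX x
    exact ⟨d, by rw [hd]; exact B.zero_mem⟩
  refine ⟨Nat.find hex, Nat.find_spec hex, fun d hd => Nat.find_min' hex hd, ?_⟩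
  have h1 := Nat.find_spec hex
  have h2 : ∀ d, (X : K[X]) ^ d • x ∈ B → Nat.find hex ≤ d := fun d hd => Nat.find_min' hex hd
  generalize Nat.find hex = e at h1 h2
  clear hex
  induction e generalizing x with
  | zero =>
    rw [sup_eq_left.mpr, add_zero]
    simpa [Submodule.span_singleton_le_iff_mem] using h1
  | succ e ih =>
    have h3 := ih ((X : K[X]) • x) (by rwa [smul_smul, ← pow_succ]) (fun d hd => by
      rw [smul_smul, ← pow_succ] at hd
      exact Nat.succ_le_succ_iff.mp (h2 _ hd))
    rw [← add_assoc, ← h3]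
    refine le_antisymm (finrank_sup_span_singleton_le B x) ?_
    by_contra hlt
    have hle : B ⊔ Submodule.span K[X] {(X : K[X]) • x} ≤ B ⊔ Submodule.span K[X] {x} := by
      refine sup_le_sup_left ?_ _
      rw [Submodule.span_singleton_le_iff_mem]
      exact Submodule.smul_mem _ _ (Submodule.mem_span_singleton_self x)
    have heq := eq_of_le_of_finrank_polynomialModule_le (K := K) hle (by omega)
    have hx : x ∈ B := by
      refine mem_of_mem_sup_span_X_smul hX ?_
      rw [heq]
      exact Submodule.mem_sup_right (Submodule.mem_span_singleton_self x)
    have := h2 0 (by simpa using hx)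
    omega

theorem finrank_sup_span_singleton_le_add [FiniteDimensional K M] {B : Submodule K[X] M} {x : M}
    {e : ℕ} (he : (X : K[X]) ^ e • x ∈ B) :
    finrank K ↥(B ⊔ Submodule.span K[X] {x}) ≤ finrank K B + e := by
  induction e generalizing x with
  | zero =>
    rw [sup_eq_left.mpr, add_zero]
    simpa [Submodule.span_singleton_le_iff_mem] using he
  | succ e ih =>
    have := ih (x := (X : K[X]) • x) (by rwa [smul_smul, ← pow_succ])
    have := finrank_sup_span_singleton_le (K := K) B x
    omega

theorem finrank_spanLT_add_le [FiniteDimensional K M] {y : ℕ → M} {a : ℕ → ℕ}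
    (h : ∀ r, (X : K[X]) ^ a r • y r = 0) (k m : ℕ) :
    finrank K (spanLT K y (k + m)) ≤
      finrank K (spanLT K y k) + ∑ r ∈ Finset.range m, a (k + r) := by
  induction m with
  | zero => simp
  | succ m ih =>
    rw [← add_assoc, spanLT_succ, Finset.sum_range_succ, ← add_assoc]
    refine (finrank_sup_span_singleton_le_add (e := a (k + m)) ?_).trans
      (Nat.add_le_add_right ih _)
    rw [h]
    exact Submodule.zero_mem _

theorem finrank_spanLT_le [FiniteDimensional K M] {y : ℕ → M} {a : ℕ → ℕ}
    (h : ∀ r, (X : K[X]) ^ a r • y r = 0) (k : ℕ) :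
    finrank K (spanLT K y k) ≤ ∑ r ∈ Finset.range k, a r := by
  have := finrank_spanLT_add_le h 0 k
  rw [spanLT_zero, finrank_polynomialModule_bot, zero_add, zero_add] at this
  simpa using this

/-! ### The type of a nilpotent module -/

/-- A `K[X]`-module of finite dimension is of type `μ` if it is the direct sum of the
`K[X] / (X ^ μ_r)`.  This is expressed through generators `x r`, one for each row of `μ`, with
`X ^ μ_r • x r = 0`; the direct sum condition is replaced by the equality of dimensions.  As the
rows of `μ` are numbered by all natural numbers, `x r = 0` when the row `r` is empty. -/
def HasType (K M : Type*) [Field K] [AddCommGroup M] [Module K M] [Module K[X] M]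
    (μ : YoungDiagram) : Prop :=
  ∃ x : ℕ → M, (∀ r, (X : K[X]) ^ μ.rowLen r • x r = 0) ∧
    Submodule.span K[X] (Set.range x) = ⊤ ∧ finrank K M = μ.card

namespace HasType

variable {μ ν : YoungDiagram}

omit [IsScalarTower K K[X] M] in
theorem finrank_eq (h : HasType K M μ) : finrank K M = μ.card := h.choose_spec.2.2

theorem of_equiv {N : Type*} [AddCommGroup N] [Module K N] [Module K[X] N]
    [IsScalarTower K K[X] N] (h : HasType K M μ) (e : M ≃ₗ[K[X]] N) : HasType K N μ := by
  obtain ⟨x, h1, h2, h3⟩ := h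
  refine ⟨fun r => e (x r), fun r => ?_, ?_, ?_⟩
  · rw [← map_smul, h1, map_zero]
  · have : Set.range (fun r => e (x r)) = (e : M →ₗ[K[X]] N) '' Set.range x := by
      rw [← Set.range_comp]; rfl
    rw [this, Submodule.span_image, h2, Submodule.map_top, LinearEquiv.range]
  · rw [← h3]
    exact ((e.restrictScalars K).finrank_eq).symm

omit [IsScalarTower K K[X] M] in
theorem pow_rowLen_zero_smul (h : HasType K M μ) (z : M) :
    (X : K[X]) ^ μ.rowLen 0 • z = 0 := by
  obtain ⟨x, h1, h2, -⟩ := h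
  have hz : z ∈ Submodule.span K[X] (Set.range x) := by rw [h2]; trivial
  induction hz using Submodule.span_induction with
  | mem z hz =>
    obtain ⟨r, rfl⟩ := hz
    rw [← Nat.sub_add_cancel (μ.rowLen_anti 0 r (Nat.zero_le r)), pow_add, mul_smul, h1, smul_zero]
  | zero => exact smul_zero _
  | add y z _ _ hy hz => rw [smul_add, hy, hz, add_zero]
  | smul p y _ hy => rw [smul_comm, hy, smul_zero]

theorem exists_pow_smul (h : HasType K M μ) (z : M) : ∃ d, (X : K[X]) ^ d • z = 0 :=
  ⟨_, h.pow_rowLen_zero_smul z⟩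

/-- The generators of the `k` largest summands. -/
theorem exists_le_finrank_spanLT [FiniteDimensional K M] (h : HasType K M μ) : ∃ y : ℕ → M,
    ∀ k, ∑ r ∈ Finset.range k, μ.rowLen r ≤ finrank K (spanLT K y k) := by
  obtain ⟨x, h1, h2, h3⟩ := h
  refine ⟨x, fun k => ?_⟩
  have hz : ∀ r, k + μ.card ≤ r → μ.rowLen r = 0 :=
    fun r hr => μ.rowLen_eq_zero_of_card_le (by omega)
  have h4 := finrank_spanLT_add_le h1 k μ.card
  rw [spanLT_eq_top h1 h2 hz, finrank_polynomialModule_top, h3] at h4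
  have h5 := μ.sum_rowLen hz
  rw [Finset.sum_range_add] at h5
  omega

end HasType

theorem finrank_map_smulX_add [FiniteDimensional K M] (N : Submodule K[X] M) :
    finrank K (N.map (smulX K M)) + finrank K ↥(N ⊓ LinearMap.ker (smulX K M)) =
      finrank K N := by
  have h := LinearMap.finrank_range_add_finrank_ker
    (((smulX K M).restrictScalars K).domRestrict (N.restrictScalars K))
  have h1 : LinearMap.range (((smulX K M).restrictScalars K).domRestrict (N.restrictScalars K)) =
      (N.map (smulX K M)).restrictScalars K := by
    ext z
    simp only [LinearMap.mem_range, LinearMap.domRestrict_apply, Subtype.exists,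
      Submodule.restrictScalars_mem, Submodule.mem_map]
    constructor
    · rintro ⟨a, ha, rfl⟩; exact ⟨a, ha, rfl⟩
    · rintro ⟨a, ha, rfl⟩; exact ⟨a, ha, rfl⟩
  have h2 : (LinearMap.ker (((smulX K M).restrictScalars K).domRestrict
      (N.restrictScalars K))).map (N.restrictScalars K).subtype =
      (N ⊓ LinearMap.ker (smulX K M)).restrictScalars K := by
    ext z
    simp only [Submodule.mem_map, LinearMap.mem_ker, LinearMap.domRestrict_apply, Subtype.exists,
      Submodule.restrictScalars_mem, Submodule.mem_inf]
    constructor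
    · rintro ⟨a, ha, hz, rfl⟩; exact ⟨ha, hz⟩
    · rintro ⟨ha, hz⟩; exact ⟨z, ha, hz, rfl⟩
  rw [h1, ← Submodule.finrank_map_subtype_eq, h2] at h
  exact h

/-- A module with `k` generators satisfies `dim N ≤ dim XN + k`. -/
theorem finrank_spanLT_le_finrank_map [FiniteDimensional K M] (y : ℕ → M) (k : ℕ) :
    finrank K (spanLT K y k) ≤ finrank K ((spanLT K y k).map (smulX K M)) + k := by
  induction k with
  | zero => rw [spanLT_zero, finrank_polynomialModule_bot]; exact Nat.zero_le _
  | succ k ih =>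
    rw [spanLT_succ]
    set P := spanLT K y k
    have hmap : (P ⊔ Submodule.span K[X] {y k}).map (smulX K M) =
        P.map (smulX K M) ⊔ Submodule.span K[X] {(X : K[X]) • y k} := by
      rw [Submodule.map_sup, Submodule.map_span, Set.image_singleton, smulX_apply]
    rw [hmap]
    have h1 := finrank_sup_span_singleton_le (K := K) P (y k)
    -- as `XP ⊆ P`, adding the generator `X • y k` enlarges `P` at most as much as `XP`
    have h2 := finrank_sup_add_finrank_inf_polynomialModule (K := K) P
      (Submodule.span K[X] {(X : K[X]) • y k})
    have h3 := finrank_sup_add_finrank_inf_polynomialModule (K := K) (P.map (smulX K M))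
      (Submodule.span K[X] {(X : K[X]) • y k})
    have h4 : P.map (smulX K M) ≤ P := by
      rintro _ ⟨z, hz, rfl⟩
      exact P.smul_mem _ hz
    have h5 := finrank_polynomialModule_mono (K := K)
      (inf_le_inf_right (Submodule.span K[X] {(X : K[X]) • y k}) h4)
    omega

/-- Counting the cells of the first `k` rows by columns. -/
theorem YoungDiagram.sum_min_colLen_le (μ : YoungDiagram) (k S : ℕ) :
    ∑ s ∈ Finset.range S, min k (μ.colLen s) ≤ ∑ r ∈ Finset.range k, μ.rowLen r := by
  have h1 : ∀ s, min k (μ.colLen s) =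
      ∑ r ∈ Finset.range k, if (r, s) ∈ μ then 1 else 0 := by
    intro s
    rw [← Finset.card_filter]
    have : (Finset.range k).filter (fun r => (r, s) ∈ μ) = Finset.range (min k (μ.colLen s)) := by
      ext r
      simp [YoungDiagram.mem_iff_lt_colLen]
    rw [this, Finset.card_range]
  simp only [h1]
  rw [Finset.sum_comm]
  refine Finset.sum_le_sum fun r _ => ?_
  rw [← Finset.card_filter]
  refine (Finset.card_le_card (t := Finset.range (μ.rowLen r)) ?_).trans (by simp)
  intro s hs
  simpa [YoungDiagram.mem_iff_lt_rowLen] using (Finset.mem_filter.mp hs).2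

/-- A submodule with `k` generators of a module of type `μ` has at most the dimension of the `k`
largest summands: `dim X^s W / X^(s+1) W` is at most `k`, and at most the length of the column `s`
of `μ`. -/
theorem HasType.finrank_spanLT_le [FiniteDimensional K M] {μ : YoungDiagram} (h : HasType K M μ)
    (y : ℕ → M) (k : ℕ) :
    finrank K (spanLT K y k) ≤ ∑ r ∈ Finset.range k, μ.rowLen r := by
  have hkill := h.pow_rowLen_zero_smul
  obtain ⟨x, h1, h2, h3⟩ := h
  set W := spanLT K y k with hW
  -- the layers of `W` and of the whole module
  have hstepW : ∀ s, finrank K (W.map (smulX K M ^ s)) ≤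
      finrank K (W.map (smulX K M ^ (s + 1))) + k := by
    intro s
    rw [pow_succ', Module.End.mul_eq_comp, Submodule.map_comp, hW, spanLT_map_pow_smulX]
    exact finrank_spanLT_le_finrank_map _ k
  have hstepM : ∀ s, finrank K ((⊤ : Submodule K[X] M).map (smulX K M ^ s)) ≤
      finrank K ((⊤ : Submodule K[X] M).map (smulX K M ^ (s + 1))) + μ.colLen s := by
    intro s
    have hgen : (⊤ : Submodule K[X] M).map (smulX K M ^ s) =
        spanLT K (fun i => (X : K[X]) ^ s • x i) (μ.colLen s) := by
      rw [← spanLT_eq_top h1 h2 (fun r => μ.rowLen_eq_zero_of_card_le), spanLT_map_pow_smulX]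
      refine le_antisymm (spanLT_le fun i _ => ?_) (spanLT_le fun i _ => ?_)
      · by_cases hi : i < μ.colLen s
        · exact mem_spanLT (fun i => (X : K[X]) ^ s • x i) hi
        · rw [← YoungDiagram.mem_iff_lt_colLen, YoungDiagram.mem_iff_lt_rowLen, not_lt] at hi
          rw [← Nat.sub_add_cancel hi, pow_add, mul_smul, h1, smul_zero]
          exact Submodule.zero_mem _
      · by_cases hi : i < μ.card
        · exact mem_spanLT (fun i => (X : K[X]) ^ s • x i) hi
        · have := h1 i
          rw [μ.rowLen_eq_zero_of_card_le (not_lt.mp hi), pow_zero, one_smul] at this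
          rw [this, smul_zero]
          exact Submodule.zero_mem _
    rw [pow_succ', Module.End.mul_eq_comp, Submodule.map_comp, hgen]
    exact finrank_spanLT_le_finrank_map _ _
  have hstep : ∀ s, finrank K (W.map (smulX K M ^ s)) ≤
      finrank K (W.map (smulX K M ^ (s + 1))) + min k (μ.colLen s) := by
    intro s
    have e1 := finrank_map_smulX_add (K := K) (W.map (smulX K M ^ s))
    have e2 := finrank_map_smulX_add (K := K) ((⊤ : Submodule K[X] M).map (smulX K M ^ s))
    rw [← Submodule.map_comp, ← Module.End.mul_eq_comp, ← pow_succ'] at e1 e2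
    have e3 := finrank_polynomialModule_mono (K := K) (inf_le_inf_right
      (LinearMap.ker (smulX K M)) (Submodule.map_mono (f := smulX K M ^ s) (le_top (a := W))))
    have := hstepW s
    have := hstepM s
    rw [← Nat.add_min_add_left, le_min_iff]
    omega
  have hsum : ∀ S, finrank K W ≤ finrank K (W.map (smulX K M ^ S)) +
      ∑ s ∈ Finset.range S, min k (μ.colLen s) := by
    intro S
    induction S with
    | zero => rw [pow_zero, Module.End.one_eq_id, Submodule.map_id]; exact Nat.le_add_right _ _
    | succ S ih =>
      rw [Finset.sum_range_succ]
      have := hstep S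
      omega
  have hzero : W.map (smulX K M ^ μ.rowLen 0) = ⊥ := by
    rw [hW, spanLT_map_pow_smulX, eq_bot_iff]
    refine spanLT_le fun i _ => ?_
    rw [hkill]
    exact Submodule.zero_mem _
  have h4 := hsum (μ.rowLen 0)
  rw [hzero, finrank_polynomialModule_bot, zero_add] at h4
  exact h4.trans (μ.sum_min_colLen_le k _)

theorem HasType.unique [FiniteDimensional K M] {μ ν : YoungDiagram} (hμ : HasType K M μ)
    (hν : HasType K M ν) : μ = ν := by
  obtain ⟨x, hx⟩ := hμ.exists_le_finrank_spanLT
  obtain ⟨y, hy⟩ := hν.exists_le_finrank_spanLT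
  have key : ∀ k, ∑ r ∈ Finset.range k, μ.rowLen r = ∑ r ∈ Finset.range k, ν.rowLen r :=
    fun k => le_antisymm ((hx k).trans (hν.finrank_spanLT_le x k))
      ((hy k).trans (hμ.finrank_spanLT_le y k))
  refine YoungDiagram.ext_rowLen fun r => ?_
  have h1 := key r
  have h2 := key (r + 1)
  rw [Finset.sum_range_succ, Finset.sum_range_succ] at h2
  omega

/-- Every nilpotent module of finite dimension has a type, by the structure theorem over the
principal ideal domain `K[X]`. -/
theorem exists_hasType [FiniteDimensional K M] (hX : ∀ x : M, ∃ d, (X : K[X]) ^ d • x = 0) :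
    ∃ μ, HasType K M μ := by
  classical
  have : Module.Finite K[X] M := Module.Finite.of_restrictScalars_finite K K[X] M
  obtain ⟨d, k, ⟨e⟩⟩ := Module.torsion_by_prime_power_decomposition (R := K[X]) (M := M)
    (p := X) Polynomial.irreducible_X (fun x => by
      obtain ⟨n, hn⟩ := hX x
      exact ⟨⟨X ^ n, n, rfl⟩, hn⟩)
  set σ := Tuple.sort (fun i => OrderDual.toDual (k i)) with hσ
  have hanti : Antitone (k ∘ σ) := fun i j hij =>
    Tuple.monotone_sort (fun i => OrderDual.toDual (k i)) hij
  set w := List.ofFn (k ∘ σ) with hw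
  have hws : w.SortedGE := by
    rw [hw, List.sortedGE_ofFn_iff]
    exact hanti
  set μ := YoungDiagram.ofRowLens w hws
  have hrow : ∀ i : Fin d, μ.rowLen i = k (σ i) := by
    intro i
    have := YoungDiagram.rowLen_ofRowLens (hw := hws) ⟨i, by simp [hw]⟩
    simpa [hw] using this
  have hrow0 : ∀ i, d ≤ i → μ.rowLen i = 0 := by
    intro i hi
    by_contra h
    have h1 : (i, 0) ∈ μ := YoungDiagram.mem_iff_lt_rowLen.mpr (Nat.pos_of_ne_zero h)
    obtain ⟨h2, -⟩ := YoungDiagram.mem_ofRowLens.mp h1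
    simp [hw] at h2
    omega
  let g : Fin d → M := fun i =>
    e.symm (DirectSum.lof K[X] (Fin d) (fun i => K[X] ⧸ K[X] ∙ (X : K[X]) ^ k i) i
      (Submodule.Quotient.mk 1))
  have hg : ∀ i, (X : K[X]) ^ k i • g i = 0 := by
    intro i
    have : (X : K[X]) ^ k i • (Submodule.Quotient.mk 1 : K[X] ⧸ K[X] ∙ (X : K[X]) ^ k i) = 0 := by
      rw [← Submodule.Quotient.mk_smul, Submodule.Quotient.mk_eq_zero, smul_eq_mul, mul_one]
      exact Submodule.mem_span_singleton_self _
    simp only [g]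
    rw [← map_smul, ← map_smul, this, map_zero, map_zero]
  have hgs : ∀ z : M, z ∈ Submodule.span K[X] (Set.range g) := by
    intro z
    obtain ⟨z, rfl⟩ := e.symm.surjective z
    induction z using DirectSum.induction_on with
    | zero => rw [map_zero]; exact Submodule.zero_mem _
    | of i q =>
      obtain ⟨p, rfl⟩ := Submodule.Quotient.mk_surjective _ q
      have : e.symm (DirectSum.of (fun i => K[X] ⧸ K[X] ∙ (X : K[X]) ^ k i) i
          (Submodule.Quotient.mk p)) = p • g i := by
        simp only [g]
        rw [← map_smul, ← map_smul, ← Submodule.Quotient.mk_smul, smul_eq_mul, mul_one]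
        rfl
      rw [this]
      exact Submodule.smul_mem _ _ (Submodule.subset_span ⟨i, rfl⟩)
    | add y z hy hz => rw [map_add]; exact Submodule.add_mem _ hy hz
  refine ⟨μ, fun r => if hr : r < d then g (σ ⟨r, hr⟩) else 0, fun r => ?_, ?_, ?_⟩
  · dsimp only
    split_ifs with hr
    · rw [hrow ⟨r, hr⟩]
      exact hg _
    · exact smul_zero _
  · rw [eq_top_iff]
    intro z _
    refine Submodule.span_mono ?_ (hgs z)
    rintro _ ⟨i, rfl⟩
    exact ⟨σ.symm i, by simp⟩
  · have hfin : ∀ i, finrank K (K[X] ⧸ K[X] ∙ (X : K[X]) ^ k i) = k i := by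
      intro i
      have := finrank_quotient_span_eq_natDegree (K := K) (f := (X : K[X]) ^ k i)
      rwa [Polynomial.natDegree_X_pow] at this
    have : ∀ i, Module.Finite K (K[X] ⧸ K[X] ∙ (X : K[X]) ^ k i) := fun i =>
      (Polynomial.monic_X_pow (R := K) (k i)).finite_quotient
    rw [(e.restrictScalars K).finrank_eq, Module.finrank_directSum, ← μ.sum_rowLen hrow0,
      ← Fin.sum_univ_eq_sum_range]
    simp only [hfin, hrow]
    exact (Equiv.sum_comp σ k).symm

end PolynomialModule

/-! ### From a chain to a submodule -/

namespace LRChain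

variable {α β γ : YoungDiagram} {l : ℕ → ℕ → ℕ}

/-- All the entries lie in the first `γ.card` rows. -/
theorem content_of_le (h : LRChain α β γ l) (i : ℕ) {R : ℕ} (hR : γ.card ≤ R) :
    ∑ r ∈ Finset.range R, l (i + 1) r = ∑ r ∈ Finset.range R, l i r + β.rowLen i := by
  obtain ⟨N, hN⟩ := h.content i
  have hz : ∀ j r, r ≥ R → l j r = 0 := fun j r hr =>
    Nat.le_zero.mp ((h.le_rowLen j r).trans (γ.rowLen_eq_zero_of_card_le (hR.trans hr)).le)
  rw [← Finset.eventually_constant_sum (hz (i + 1)) (le_max_right N R),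
    ← Finset.eventually_constant_sum (hz i) (le_max_right N R)]
  exact hN _ (le_max_left _ _)

theorem card_eq (h : LRChain α β γ l) : γ.card = α.card + β.card := by
  obtain ⟨N, hN⟩ := h.eventually
  have h1 : ∀ i, ∑ r ∈ Finset.range γ.card, l i r =
      α.card + ∑ j ∈ Finset.range i, β.rowLen j := by
    intro i
    induction i with
    | zero =>
      simp only [h.zero, Finset.range_zero, Finset.sum_empty, add_zero]
      refine α.sum_rowLen fun r hr => ?_
      rw [← h.zero]
      exact Nat.le_zero.mp ((h.le_rowLen 0 r).trans (γ.rowLen_eq_zero_of_card_le hr).le)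
    | succ i ih => rw [h.content_of_le i le_rfl, ih, Finset.sum_range_succ, add_assoc]
  have h2 := h1 (max N β.card)
  rw [β.sum_rowLen fun r hr => β.rowLen_eq_zero_of_card_le ((le_max_right _ _).trans hr)] at h2
  rw [← h2]
  refine (γ.sum_rowLen fun r => γ.rowLen_eq_zero_of_card_le).symm.trans ?_
  exact Finset.sum_congr rfl fun r _ => (hN _ (le_max_left _ _) r).symm

end LRChain

section Construction

open Module (finrank)

variable {K M : Type*} [Field K] [AddCommGroup M] [Module K[X] M]

/-- Going down from a sequence of generators by the bidiagonal matrices with entries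
`X ^ (l (i + 1) r - l i r)` on the diagonal and `-1` above it. -/
theorem exists_bidiagonal_sequence (x : ℕ → M) (l : ℕ → ℕ → ℕ) (n : ℕ) :
    ∃ y : ℕ → ℕ → M, y n = x ∧ ∀ i < n, ∀ r,
      y i r = (X : K[X]) ^ (l (i + 1) r - l i r) • y (i + 1) r - y (i + 1) (r + 1) := by
  refine ⟨fun i => Nat.rec (motive := fun _ => ℕ → M) x (fun s z r =>
    (X : K[X]) ^ (l (n - s) r - l (n - s - 1) r) • z r - z (r + 1)) (n - i), by simp, ?_⟩
  intro i hi r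
  obtain ⟨s, rfl⟩ : ∃ s, n = i + 1 + s := ⟨n - (i + 1), by omega⟩
  have h1 : i + 1 + s - i = s + 1 := by omega
  have h2 : i + 1 + s - (i + 1) = s := by omega
  have h3 : i + 1 + s - s = i + 1 := by omega
  simp only [h1, h2, h3, Nat.add_sub_cancel]

/-- A Littlewood-Richardson chain of type `(α, β; γ)` gives, in a module of type `γ`, a submodule of
type `α` whose quotient is of type `β`.  If `x` are the standard generators of the module, the
submodule is generated by `B₁ ⋯ B_n x`, where `B_i` is the bidiagonal matrix with the powers of `X`
given by the `i`-th strip on its diagonal.  The lattice condition is what makes the successive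
cyclic quotients split. -/
theorem LRChain.exists_submodule [Module K M] [IsScalarTower K K[X] M] [FiniteDimensional K M]
    {α β γ : YoungDiagram} {l : ℕ → ℕ → ℕ} (h : LRChain α β γ l) (hM : HasType K M γ) :
    ∃ N : Submodule K[X] M, HasType K N α ∧ HasType K (M ⧸ N) β := by
  obtain ⟨x, hx1, hx2, hx3⟩ := hM
  obtain ⟨n, hn⟩ := h.eventually
  obtain ⟨y, hyn, hy⟩ := exists_bidiagonal_sequence (K := K) x l n
  -- the partial sums of the strips
  set D : ℕ → ℕ → ℕ := fun i R => ∑ r ∈ Finset.range R, (l (i + 1) r - l i r) with hD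
  have hDsum : ∀ i R, D i R + ∑ r ∈ Finset.range R, l i r =
      ∑ r ∈ Finset.range R, l (i + 1) r := by
    intro i R
    rw [hD, ← Finset.sum_add_distrib]
    exact Finset.sum_congr rfl fun r _ => Nat.sub_add_cancel (h.mono i r)
  have hDlat : ∀ i R, D (i + 1) (R + 1) ≤ D i R := by
    intro i R
    have h1 := hDsum (i + 1) (R + 1)
    have h2 := hDsum i R
    have h3 := h.lattice i R
    simp only [add_assoc, Nat.reduceAdd] at h1 h3 ⊢
    omega
  have hDcontent : ∀ i, D i γ.card = β.rowLen i := by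
    intro i
    have h1 := hDsum i γ.card
    have h2 := h.content_of_le i le_rfl
    omega
  have hkill : ∀ s i, i + s = n → ∀ r, (X : K[X]) ^ l i r • y i r = 0 := by
    intro s
    induction s with
    | zero =>
      rintro i rfl r
      simp only [add_zero] at hyn hn
      rw [hyn, hn i le_rfl, hx1]
    | succ s ih =>
      intro i hi r
      rw [hy i (by omega), smul_sub, smul_smul, ← pow_add, Nat.add_sub_cancel' (h.mono i r),
        ih (i + 1) (by omega), ← Nat.sub_add_cancel (h.strip i r), pow_add, mul_smul,
        ih (i + 1) (by omega), smul_zero, sub_zero]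
  have hzero : ∀ i ≤ n, ∀ r, γ.card ≤ r → y i r = 0 := by
    intro i hi r hr
    have h1 := hkill (n - i) i (by omega) r
    rwa [Nat.le_zero.mp ((h.le_rowLen i r).trans (γ.rowLen_eq_zero_of_card_le hr).le), pow_zero,
      one_smul] at h1
  set N : ℕ → Submodule K[X] M := fun i => Submodule.span K[X] (Set.range (y i)) with hN
  have hyN : ∀ i r, y i r ∈ N i := fun i r => Submodule.subset_span ⟨r, rfl⟩
  have hNmono : ∀ i < n, N i ≤ N (i + 1) := by
    intro i hi
    rw [hN, Submodule.span_le]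
    rintro _ ⟨r, rfl⟩
    rw [hy i hi]
    exact (N (i + 1)).sub_mem ((N (i + 1)).smul_mem _ (hyN _ _)) (hyN _ _)
  -- every generator of `N (i + 1)` is a multiple of the first one, up to the same multiple of an
  -- element of `N i`, modulo `N 0`
  have hstep : ∀ i < n, ∀ r, ∃ a ∈ N i, ∃ b ∈ N 0,
      y (i + 1) r = (X : K[X]) ^ D i r • (y (i + 1) 0 + a) + b := by
    intro i
    induction i with
    | zero =>
      intro hi r
      induction r with
      | zero => exact ⟨0, Submodule.zero_mem _, 0, Submodule.zero_mem _, by simp [hD]⟩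
      | succ r ih =>
        obtain ⟨a, ha, b, hb, hr⟩ := ih
        refine ⟨a, ha, (X : K[X]) ^ (l (0 + 1) r - l 0 r) • b - y 0 r,
          (N 0).sub_mem ((N 0).smul_mem _ hb) (hyN 0 r), ?_⟩
        have h1 : y (0 + 1) (r + 1) =
            (X : K[X]) ^ (l (0 + 1) r - l 0 r) • y (0 + 1) r - y 0 r := by
          rw [hy 0 hi]; abel
        have h2 : D 0 (r + 1) = (l (0 + 1) r - l 0 r) + D 0 r := by
          rw [hD]; dsimp only; rw [Finset.sum_range_succ, add_comm]
        rw [h1, h2, hr, smul_add, smul_smul, ← pow_add, add_sub_assoc]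
    | succ i ihi =>
      intro hi r
      induction r with
      | zero => exact ⟨0, Submodule.zero_mem _, 0, Submodule.zero_mem _, by simp [hD]⟩
      | succ r ih =>
        obtain ⟨a, ha, b, hb, hr⟩ := ih
        obtain ⟨a', ha', b', hb', hr'⟩ := ihi (by omega) r
        obtain ⟨d, hd⟩ : ∃ d, D i r = D (i + 1) (r + 1) + d :=
          ⟨D i r - D (i + 1) (r + 1), by have := hDlat i r; omega⟩
        refine ⟨a - (X : K[X]) ^ d • (y (i + 1) 0 + a'),
          (N (i + 1)).sub_mem ha ((N (i + 1)).smul_mem _ ((N (i + 1)).add_mem (hyN _ _)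
            (hNmono i (by omega) ha'))),
          (X : K[X]) ^ (l (i + 1 + 1) r - l (i + 1) r) • b - b',
          (N 0).sub_mem ((N 0).smul_mem _ hb) hb', ?_⟩
        have h1 : y (i + 1 + 1) (r + 1) =
            (X : K[X]) ^ (l (i + 1 + 1) r - l (i + 1) r) • y (i + 1 + 1) r - y (i + 1) r := by
          rw [hy (i + 1) hi]; abel
        have h2 : D (i + 1) (r + 1) = (l (i + 1 + 1) r - l (i + 1) r) + D (i + 1) r := by
          rw [hD]; dsimp only; rw [Finset.sum_range_succ, add_comm]
        have h3 : y (i + 1) r = (X : K[X]) ^ D (i + 1) (r + 1) •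
            (X : K[X]) ^ d • (y (i + 1) 0 + a') + b' := by
          rw [smul_smul, ← pow_add, ← hd]; exact hr'
        have h4 : (X : K[X]) ^ (l (i + 1 + 1) r - l (i + 1) r) • y (i + 1 + 1) r =
            (X : K[X]) ^ D (i + 1) (r + 1) • (y (i + 1 + 1) 0 + a) +
              (X : K[X]) ^ (l (i + 1 + 1) r - l (i + 1) r) • b := by
          rw [hr, smul_add, smul_smul, ← pow_add, ← h2]
        rw [h1, h3, h4]
        simp only [smul_add, smul_sub]
        abel
  have hw : ∀ i, ∃ w : M, (X : K[X]) ^ β.rowLen i • w ∈ N 0 ∧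
      (i < n → N (i + 1) ≤ N i ⊔ Submodule.span K[X] {w}) := by
    intro i
    by_cases hi : i < n
    · obtain ⟨a, ha, b, hb, hr⟩ := hstep i hi γ.card
      rw [hzero (i + 1) hi _ le_rfl, hDcontent] at hr
      refine ⟨y (i + 1) 0 + a, ?_, fun _ => ?_⟩
      · rw [← neg_eq_of_add_eq_zero_left hr.symm]
        exact (N 0).neg_mem hb
      · have h0 : ∀ r, y (i + 1) r ∈ N i ⊔ Submodule.span K[X] {y (i + 1) 0 + a} := by
          intro r
          induction r with
          | zero =>
            exact mem_sup_span_singleton_iff.mpr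
              ⟨-a, (N i).neg_mem ha, 1, by rw [one_smul]; abel⟩
          | succ r ih =>
            have : y (i + 1) (r + 1) =
                (X : K[X]) ^ (l (i + 1) r - l i r) • y (i + 1) r - y i r := by
              rw [hy i hi]; abel
            rw [this]
            exact Submodule.sub_mem _ (Submodule.smul_mem _ _ ih)
              (Submodule.mem_sup_left (hyN i r))
        exact Submodule.span_le.mpr (by rintro _ ⟨r, rfl⟩; exact h0 r)
    · exact ⟨0, by rw [smul_zero]; exact Submodule.zero_mem _, fun h => absurd h hi⟩
  choose w hw1 hw2 using hw
  have hNle : ∀ i ≤ n, N i ≤ N 0 ⊔ Submodule.span K[X] (Set.range w) := by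
    intro i
    induction i with
    | zero => exact fun _ => le_sup_left
    | succ i ih =>
      intro hi
      refine (hw2 i hi).trans (sup_le (ih (by omega)) (le_sup_of_le_right ?_))
      exact Submodule.span_mono (by rintro _ rfl; exact ⟨i, rfl⟩)
  have hNn : N n = ⊤ := by rw [hN]; dsimp only; rw [hyn, hx2]
  -- the generators of the submodule and of the quotient
  set u : ℕ → N 0 := fun r => ⟨y 0 r, hyN 0 r⟩ with hu
  have hu1 : ∀ r, (X : K[X]) ^ α.rowLen r • u r = 0 := by
    intro r
    rw [← h.zero]
    exact Subtype.ext (hkill n 0 (by omega) r)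
  have hu2 : Submodule.span K[X] (Set.range u) = ⊤ := by
    refine Submodule.map_injective_of_injective (N 0).injective_subtype ?_
    rw [Submodule.map_span, Submodule.map_top, Submodule.range_subtype, ← Set.range_comp]
    rfl
  set v : ℕ → M ⧸ N 0 := fun i => (N 0).mkQ (w i) with hv
  have hv1 : ∀ i, (X : K[X]) ^ β.rowLen i • v i = 0 := by
    intro i
    rw [hv]
    dsimp only
    rw [← map_smul, Submodule.mkQ_apply, Submodule.Quotient.mk_eq_zero]
    exact hw1 i
  have hv2 : Submodule.span K[X] (Set.range v) = ⊤ := by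
    have h1 : Set.range v = (N 0).mkQ '' Set.range w := by rw [← Set.range_comp]; rfl
    rw [h1, ← Submodule.map_span, eq_top_iff, ← (N 0).range_mkQ, ← Submodule.map_top, ← hNn]
    refine (Submodule.map_mono (hNle n le_rfl)).trans ?_
    rw [Submodule.map_sup, Submodule.mkQ_map_self, bot_sup_eq]
  have hd1 : finrank K (N 0) ≤ α.card := by
    have := finrank_spanLT_le (K := K) (M := N 0) (y := u) hu1 α.card
    rwa [spanLT_eq_top hu1 hu2 (fun r => α.rowLen_eq_zero_of_card_le),
      finrank_polynomialModule_top, α.sum_rowLen (fun r => α.rowLen_eq_zero_of_card_le)] at this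
  have hd2 : finrank K (M ⧸ N 0) ≤ β.card := by
    have := finrank_spanLT_le (K := K) (M := M ⧸ N 0) (y := v) hv1 β.card
    rwa [spanLT_eq_top hv1 hv2 (fun r => β.rowLen_eq_zero_of_card_le),
      finrank_polynomialModule_top, β.sum_rowLen (fun r => β.rowLen_eq_zero_of_card_le)] at this
  have hd3 := finrank_quotient_add_finrank_polynomialModule (K := K) (N 0)
  have hd4 := h.card_eq
  exact ⟨N 0, ⟨u, hu1, hu2, by omega⟩, ⟨v, hv1, hv2, by omega⟩⟩

end Construction

/-! ### From a hive to a chain -/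

/-- The three rhombus inequalities of a hive, together with its boundary values, give a chain. -/
theorem exists_lrChain_of_rhombus {α β γ : YoungDiagram} {m : ℕ → ℕ → ℕ}
    (hα : ∀ k, m 0 k = ∑ r ∈ Finset.range k, α.rowLen r)
    (hγ : ∀ k, m k 0 = ∑ r ∈ Finset.range k, γ.rowLen r)
    (hβ : ∀ i j, α.card ≤ j → m i j = α.card + ∑ r ∈ Finset.range i, β.rowLen r)
    (hmono : ∀ i j, m i j ≤ m i (j + 1)) (hle : ∀ i j, m i (j + 1) ≤ m (i + 1) j)
    (hmodular : ∀ i j, m (i + 1) (j + 1) + m i j ≤ m (i + 1) j + m i (j + 1))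
    (hupper : ∀ i j, m (i + 2) j + m i (j + 1) ≤ m (i + 1) (j + 1) + m (i + 1) j)
    (hlower : ∀ i j, m i (j + 2) + m (i + 1) j ≤ m (i + 1) (j + 1) + m i (j + 1)) :
    ∃ l, LRChain α β γ l := by
  -- `S i R` is the number of cells with entry at most `i` in the rows before `R`
  set S : ℕ → ℕ → ℕ := fun i R => if R ≤ i then m R 0 else m i (R - i) with hS
  set l : ℕ → ℕ → ℕ := fun i r => if r < i then γ.rowLen r else m i (r - i + 1) - m i (r - i)
    with hl
  have hl1 : ∀ i r, r < i → l i r = γ.rowLen r := fun i r h => by simp [hl, h]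
  have hl2 : ∀ i j, l i (i + j) = m i (j + 1) - m i j := fun i j => by simp [hl]
  have hS1 : ∀ i R, R ≤ i → S i R = m R 0 := fun i R h => by simp [hS, h]
  have hS2 : ∀ i j, S i (i + j) = m i j := by
    intro i j
    rcases j with _ | j
    · simp [hS]
    · simp [hS]
  have hsum : ∀ i R, ∑ r ∈ Finset.range R, l i r = S i R := by
    intro i R
    induction R with
    | zero => rw [hS1 i 0 (Nat.zero_le i), hγ]; simp
    | succ R ih =>
      rw [Finset.sum_range_succ, ih]
      rcases lt_or_ge R i with h | h
      · rw [hl1 i R h, hS1 i R h.le, hS1 i (R + 1) h, hγ, hγ, Finset.sum_range_succ]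
      · obtain ⟨j, rfl⟩ := Nat.exists_eq_add_of_le h
        rw [hl2, hS2, add_assoc, hS2]
        have := hmono i j
        omega
  have hlmono : ∀ i r, l i r ≤ l (i + 1) r := by
    intro i r
    rcases lt_trichotomy r i with h | rfl | h
    · rw [hl1 i r h, hl1 (i + 1) r (by omega)]
    · have h1 := hl2 r 0
      have h2 := hle r 0
      have h3 := hγ (r + 1)
      have h4 := hγ r
      rw [Finset.sum_range_succ, ← h4] at h3
      rw [add_zero] at h1
      rw [h1, hl1 (r + 1) r (by omega)]
      omega
    · obtain ⟨j, rfl⟩ : ∃ j, r = i + (j + 1) := ⟨r - i - 1, by omega⟩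
      rw [hl2, show i + (j + 1) = i + 1 + j by omega, hl2]
      have := hlower i j
      have := hmono i (j + 1)
      have := hmono (i + 1) j
      simp only [add_assoc, Nat.reduceAdd] at *
      omega
  have hlevent : ∀ i, γ.card ≤ i → ∀ r, l i r = γ.rowLen r := by
    intro i hi r
    rcases lt_or_ge r i with h | h
    · exact hl1 i r h
    · have h1 : l i r ≤ l (r + 1) r :=
        monotone_nat_of_le_succ (f := fun i => l i r) (fun i => hlmono i r) (by omega)
      rw [hl1 (r + 1) r (by omega), γ.rowLen_eq_zero_of_card_le (hi.trans h)] at h1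
      rw [γ.rowLen_eq_zero_of_card_le (hi.trans h)]
      omega
  refine ⟨l, ?_, hlmono, ⟨γ.card, hlevent⟩, ?_, ?_, ?_⟩
  · intro r
    have h1 := hl2 0 r
    rw [zero_add] at h1
    rw [h1, hα, hα, Finset.sum_range_succ]
    omega
  · intro i r
    rcases lt_or_ge r i with h | h
    · rw [hl1 i r h, hl1 (i + 1) (r + 1) (by omega)]
      exact γ.rowLen_anti _ _ (Nat.le_succ r)
    · obtain ⟨j, rfl⟩ := Nat.exists_eq_add_of_le h
      rw [hl2, show i + j + 1 = i + 1 + j by omega, hl2]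
      have := hmodular i j
      have := hmono i j
      omega
  · intro i
    refine ⟨i + 1 + α.card, fun R hR => ?_⟩
    obtain ⟨j, rfl⟩ := Nat.exists_eq_add_of_le hR
    rw [hsum, hsum, show i + 1 + α.card + j = i + 1 + (α.card + j) by omega, hS2,
      show i + 1 + (α.card + j) = i + (α.card + j + 1) by omega, hS2, hβ _ _ (by omega),
      hβ _ _ (by omega), Finset.sum_range_succ]
    omega
  · intro i R
    rw [hsum, hsum, hsum, hsum]
    rcases lt_or_ge i R with h | h
    · obtain ⟨j, rfl⟩ : ∃ j, R = i + (j + 1) := ⟨R - i - 1, by omega⟩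
      rw [hS2, show i + (j + 1) + 1 = i + 2 + j by omega, hS2,
        show i + 2 + j = i + 1 + (j + 1) by omega, hS2, show i + (j + 1) = i + 1 + j by omega, hS2]
      have := hupper i j
      omega
    · rw [hS1 _ _ h, hS1 _ _ (by omega), hS1 _ _ (by omega), hS1 _ _ (by omega)]
      omega

/-! ### Generic points -/

section Generic

variable {K E M : Type*} [Field K] [AddCommGroup E] [Module K E] [AddCommGroup M] [Module K M]

/-- A property of the points of a vector space that persists, on each line through a point where it
holds, outside of a finite set. -/
def LineOpen (K : Type*) {E : Type*} [Field K] [AddCommGroup E] [Module K E] (P : E → Prop) :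
    Prop :=
  ∀ p q, P p → {s : K | ¬ P (p + s • q)}.Finite

/-- Finitely many line-open properties, each of which holds somewhere, hold together somewhere. -/
theorem exists_forall_of_lineOpen [Infinite K] {ι : Type*} {P : ι → E → Prop}
    (hP : ∀ i, LineOpen K (P i)) (hne : ∀ i, ∃ p, P i p) (S : Finset ι) :
    ∃ p, ∀ i ∈ S, P i p := by
  classical
  induction S using Finset.induction_on with
  | empty => exact ⟨0, by simp⟩
  | insert i S _ ih =>
    obtain ⟨p, hp⟩ := ih
    obtain ⟨q, hq⟩ := hne i
    have h1 : (⋃ j ∈ S, {s : K | ¬ P j (p + s • (q - p))}).Finite :=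
      S.finite_toSet.biUnion fun j hj => hP j p _ (hp j hj)
    have h2 : ((fun s : K => 1 - s) ⁻¹' {s : K | ¬ P i (q + s • (p - q))}).Finite :=
      (hP i q _ hq).preimage (sub_right_injective.injOn)
    obtain ⟨s, hs⟩ := (h1.union h2).exists_notMem
    rw [Set.mem_union, not_or] at hs
    refine ⟨p + s • (q - p), fun j hj => ?_⟩
    rcases Finset.mem_insert.mp hj with rfl | hj
    · have h3 := hs.2
      simp only [Set.mem_preimage, Set.mem_ofPred_eq, not_not] at h3
      convert h3 using 1
      module
    · have h3 := hs.1
      simp only [Set.mem_iUnion, Set.mem_ofPred_eq, not_exists, not_not] at h3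
      exact h3 j hj

/-- Vectors depending linearly on a parameter stay independent on a line, outside of the roots of a
determinant. -/
theorem lineOpen_linearIndependent {ι : Type*} [Finite ι] (f : ι → E →ₗ[K] M) :
    LineOpen K fun p => LinearIndependent K fun t => f t p := by
  classical
  have := Fintype.ofFinite ι
  intro p q hp
  obtain ⟨φ, hφ⟩ := LinearMap.exists_leftInverse_of_injective
    (Fintype.linearCombination K fun t => f t p)
    (LinearMap.ker_eq_bot.mpr (linearIndependent_iff_injective_fintypeLinearCombination.mp hp))
  have hφ1 : ∀ t u, φ (f t p) u = (1 : Matrix ι ι K) t u := by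
    intro t u
    have h1 := LinearMap.congr_fun hφ (Pi.single t 1)
    rw [LinearMap.comp_apply, Fintype.linearCombination_apply_single, one_smul,
      LinearMap.id_apply] at h1
    rw [h1, Matrix.one_apply, Pi.single_apply]
    simp only [eq_comm]
  set B : Matrix ι ι K := Matrix.of fun t u => φ (f t q) u with hB
  -- the determinant of the coordinates is a polynomial in `s` with value `1` at `s = 0`
  set d : K[X] := (1 + (X : K[X]) • B.map C).det with hd
  have hdev : ∀ s, d.eval s = (1 + s • B).det := by
    intro s
    rw [hd, ← Polynomial.coe_evalRingHom, RingHom.map_det]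
    congr 1
    ext t u
    simp [Matrix.one_apply, apply_ite]
    exact mul_comm _ _
  have hd0 : d ≠ 0 := by
    intro h
    have := hdev 0
    rw [h] at this
    simp at this
  refine (Polynomial.finite_setOfPred_isRoot hd0).subset fun s hs => ?_
  by_contra hroot
  refine hs (LinearIndependent.of_comp φ ?_)
  have h2 : (1 + s • B).det ≠ 0 := by rw [← hdev]; exact hroot
  have h3 := Matrix.linearIndependent_rows_of_det_ne_zero h2
  have h4 : (φ ∘ fun t => f t (p + s • q)) = fun t => (1 + s • B) t := by
    funext t
    ext u
    simp [hφ1, hB]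
  rw [h4]
  exact h3

variable [Module K[X] M] [IsScalarTower K K[X] M]

open Module (finrank)

theorem restrictScalars_span_polynomial (s : Set M) :
    (Submodule.span K[X] s).restrictScalars K =
      Submodule.span K {z | ∃ a : ℕ, ∃ y ∈ s, (X : K[X]) ^ a • y = z} := by
  refine le_antisymm ?_ (Submodule.span_le.mpr ?_)
  · intro z hz
    rw [Submodule.restrictScalars_mem] at hz
    induction hz using Submodule.span_induction with
    | mem z hz => exact Submodule.subset_span ⟨0, z, hz, by simp⟩
    | zero => exact Submodule.zero_mem _
    | add y z _ _ hy hz => exact Submodule.add_mem _ hy hz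
    | smul p z hz' hz =>
      clear hz'
      induction p using Polynomial.induction_on' with
      | add p q hp hq => rw [add_smul]; exact Submodule.add_mem _ hp hq
      | monomial n c =>
        rw [← Polynomial.C_mul_X_pow_eq_monomial, ← Polynomial.smul_eq_C_mul, smul_assoc]
        refine Submodule.smul_mem _ _ ?_
        induction hz using Submodule.span_induction with
        | mem z hz =>
          obtain ⟨a, y, hy, rfl⟩ := hz
          exact Submodule.subset_span ⟨n + a, y, hy, by rw [pow_add, mul_smul]⟩
        | zero => rw [smul_zero]; exact Submodule.zero_mem _
        | add y z _ _ hy hz => rw [smul_add]; exact Submodule.add_mem _ hy hz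
        | smul c z _ hz => rw [smul_comm]; exact Submodule.smul_mem _ _ hz
  · rintro _ ⟨a, y, hy, rfl⟩
    exact Submodule.smul_mem _ _ (Submodule.subset_span hy)

/-- The dimension of the submodule generated by vectors depending linearly on a parameter is lower
semicontinuous. -/
theorem lineOpen_le_finrank_span [FiniteDimensional K M] {κ : Type*} (g : κ → E →ₗ[K] M) (c : ℕ) :
    LineOpen K fun p => c ≤ finrank K (Submodule.span K[X] (Set.range fun t => g t p)) := by
  classical
  intro p q hp
  obtain ⟨b, hb1, hb2, hb3⟩ := exists_linearIndependent K
    {z | ∃ a : ℕ, ∃ y ∈ Set.range fun t => g t p, (X : K[X]) ^ a • y = z}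
  have hidx : ∀ x : b, ∃ a : ℕ, ∃ t, (X : K[X]) ^ a • g t p = x := by
    rintro ⟨x, hx⟩
    obtain ⟨a, _, ⟨t, rfl⟩, h⟩ := hb1 hx
    exact ⟨a, t, h⟩
  choose a t hat using hidx
  have hfin : Finite b := hb3.setFinite
  have := Fintype.ofFinite b
  set f : b → E →ₗ[K] M := fun x =>
    (LinearMap.lsmul K[X] M ((X : K[X]) ^ a x)).restrictScalars K ∘ₗ g (t x) with hf
  have hfa : ∀ x p, f x p = (X : K[X]) ^ a x • g (t x) p := fun _ _ => rfl
  have hcard : finrank K (Submodule.span K[X] (Set.range fun t => g t p)) = Fintype.card b := by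
    change finrank K ((Submodule.span K[X] (Set.range fun t => g t p)).restrictScalars K) = _
    rw [restrictScalars_span_polynomial, ← hb2]
    have := finrank_span_eq_card hb3
    rwa [Subtype.range_coe] at this
  have hli : LinearIndependent K fun x => f x p := by
    convert hb3 using 1
    funext x
    rw [hfa, hat]
  refine (lineOpen_linearIndependent f p q hli).subset fun s hs hs' => hs ?_
  rw [hcard] at hp
  refine hp.trans ?_
  rw [← finrank_span_eq_card hs']
  change _ ≤ finrank K
    ((Submodule.span K[X] (Set.range fun t => g t (p + s • q))).restrictScalars K)
  refine Submodule.finrank_mono (Submodule.span_le.mpr ?_)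
  rintro _ ⟨x, rfl⟩
  have hx : g (t x) (p + s • q) ∈ Set.range fun t => g t (p + s • q) := ⟨t x, rfl⟩
  exact Submodule.smul_mem (Submodule.span K[X] _) _ (Submodule.subset_span hx)

end Generic

/-! ### The hive of a submodule -/

section Hive

open Module (finrank)

variable {K M : Type*} [Field K] [AddCommGroup M] [Module K[X] M]

/-- Any two elements `p • w`, `q • w` of a cyclic nilpotent module are comparable. -/
theorem exists_smul_eq_or_exists_smul_eq {w : M} (hw : ∃ d, (X : K[X]) ^ d • w = 0) (p q : K[X]) :
    (∃ g : K[X], q • w = g • p • w) ∨ ∃ g : K[X], p • w = (X * g) • q • w := by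
  obtain ⟨d, hd⟩ := hw
  have hfac : ∀ p : K[X], p ≠ 0 → ∃ s : ℕ, ∃ p₀ b : K[X], p = X ^ s * p₀ ∧ (b * p₀) • w = w := by
    intro p hp
    obtain ⟨p₀, h1, h2⟩ := Polynomial.exists_eq_pow_rootMultiplicity_mul_and_not_dvd p hp 0
    rw [C_0, sub_zero] at h1 h2
    obtain ⟨a, b, hab⟩ : IsCoprime ((X : K[X]) ^ d) p₀ :=
      ((Polynomial.irreducible_X.coprime_iff_not_dvd).mpr h2).pow_left
    refine ⟨_, p₀, b, h1, ?_⟩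
    have := congrArg (· • w) hab
    simpa [add_smul, mul_smul, hd] using this
  by_cases hp : p = 0
  · exact Or.inr ⟨0, by simp [hp]⟩
  by_cases hq : q = 0
  · exact Or.inl ⟨0, by simp [hq]⟩
  obtain ⟨s, p₀, b, rfl, hb⟩ := hfac p hp
  obtain ⟨s', q₀, b', rfl, hb'⟩ := hfac q hq
  rcases le_or_gt s s' with h | h
  · obtain ⟨k, rfl⟩ := Nat.exists_eq_add_of_le h
    refine Or.inl ⟨X ^ k * q₀ * b, ?_⟩
    nth_rewrite 1 [← hb]
    simp only [smul_smul]
    congr 1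
    ring
  · obtain ⟨k, rfl⟩ := Nat.exists_eq_add_of_lt h
    refine Or.inr ⟨X ^ k * p₀ * b', ?_⟩
    nth_rewrite 1 [← hb']
    simp only [smul_smul]
    congr 1
    ring

/-- The submodule generated by `v 0, …, v (i - 1)` in `M` and by `u 0, …, u (j - 1)` in `N`. -/
noncomputable def pairSpan {N : Submodule K[X] M} (v : ℕ → M) (u : ℕ → N) (i j : ℕ) :
    Submodule K[X] M :=
  spanLT K v i ⊔ spanLT K (fun k => (u k : M)) j

variable {N : Submodule K[X] M}

theorem pairSpan_succ_left (v : ℕ → M) (u : ℕ → N) (i j : ℕ) :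
    pairSpan v u (i + 1) j = pairSpan v u i j ⊔ Submodule.span K[X] {v i} := by
  rw [pairSpan, spanLT_succ, pairSpan, sup_right_comm]

theorem pairSpan_succ_right (v : ℕ → M) (u : ℕ → N) (i j : ℕ) :
    pairSpan v u i (j + 1) = pairSpan v u i j ⊔ Submodule.span K[X] {(u j : M)} := by
  rw [pairSpan, spanLT_succ, pairSpan, sup_assoc]

theorem spanLT_congr {y z : ℕ → M} {k : ℕ} (h : ∀ i < k, y i = z i) :
    spanLT K y k = spanLT K z k := by
  rw [spanLT, spanLT]
  congr 1
  exact Set.image_congr h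

theorem spanLT_coe (u : ℕ → N) (k : ℕ) :
    spanLT K (fun i => (u i : M)) k = (spanLT K u k).map N.subtype := by
  rw [spanLT, spanLT, Submodule.map_span, Set.image_image]
  rfl

variable [Module K M] [IsScalarTower K K[X] M]

theorem finrank_map_subtype_polynomialModule (P : Submodule K[X] N) :
    finrank K (P.map N.subtype) = finrank K P :=
  ((P.equivMapOfInjective N.subtype N.injective_subtype).restrictScalars K).finrank_eq.symm

/-- If `x ∈ L` is generic in `L`, both modulo `A` and modulo `A` and `w`, then a further element of
`L` adds no more dimensions to `A` and `x` than `x` adds to `A` and `w`.  Indeed, if `x` adds `e`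
dimensions to `A` and `w`, then modulo `A` all of `X ^ e L` is in the uniserial module generated by
`w`, hence is generated by `X ^ e • x`. -/
theorem finrank_add_le_of_generic [FiniteDimensional K M]
    (hX : ∀ x : M, ∃ d, (X : K[X]) ^ d • x = 0) {A L : Submodule K[X] M} {w x x' : M}
    (hx' : x' ∈ L)
    (hw : ∀ z ∈ L, finrank K ↥(A ⊔ Submodule.span K[X] {w} ⊔ Submodule.span K[X] {z}) ≤
      finrank K ↥(A ⊔ Submodule.span K[X] {w} ⊔ Submodule.span K[X] {x}))
    (hA : ∀ z ∈ L, finrank K ↥(A ⊔ Submodule.span K[X] {z}) ≤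
      finrank K ↥(A ⊔ Submodule.span K[X] {x})) :
    finrank K ↥(A ⊔ Submodule.span K[X] {x} ⊔ Submodule.span K[X] {x'}) +
        finrank K ↥(A ⊔ Submodule.span K[X] {w}) ≤
      finrank K ↥(A ⊔ Submodule.span K[X] {w} ⊔ Submodule.span K[X] {x}) +
        finrank K ↥(A ⊔ Submodule.span K[X] {x}) := by
  have hpow : ∀ (B : Submodule K[X] M) (z : M) (a b : ℕ), a ≤ b → (X : K[X]) ^ a • z ∈ B →
      (X : K[X]) ^ b • z ∈ B := by
    intro B z a b hab h
    rw [← Nat.sub_add_cancel hab, pow_add, mul_smul]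
    exact B.smul_mem _ h
  have hgen : ∀ B : Submodule K[X] M, (∀ z ∈ L, finrank K ↥(B ⊔ Submodule.span K[X] {z}) ≤
      finrank K ↥(B ⊔ Submodule.span K[X] {x})) → ∃ e, (X : K[X]) ^ e • x ∈ B ∧
        (∀ d, (X : K[X]) ^ d • x ∈ B → e ≤ d) ∧ (∀ z ∈ L, (X : K[X]) ^ e • z ∈ B) ∧
        finrank K ↥(B ⊔ Submodule.span K[X] {x}) = finrank K B + e := by
    intro B hB
    obtain ⟨e, h1, h2, h3⟩ := exists_order hX B x
    refine ⟨e, h1, h2, fun z hz => ?_, h3⟩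
    obtain ⟨e', h1', -, h3'⟩ := exists_order hX B z
    have := hB z hz
    exact hpow B z e' e (by omega) h1'
  obtain ⟨e, he1, -, he2, he3⟩ := hgen _ hw
  obtain ⟨d, hd1, hd2, hd3, -⟩ := hgen _ hA
  obtain ⟨a, ha, p, hp⟩ := mem_sup_span_singleton_iff.mp he1
  obtain ⟨a', ha', q, hq⟩ := mem_sup_span_singleton_iff.mp (he2 x' hx')
  have key : (X : K[X]) ^ e • x' ∈ A ⊔ Submodule.span K[X] {x} := by
    by_cases hmem : (X : K[X]) ^ e • x' ∈ A
    · exact Submodule.mem_sup_left hmem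
    rcases exists_smul_eq_or_exists_smul_eq (hX w) p q with ⟨g, hg⟩ | ⟨g, hg⟩
    · refine mem_sup_span_singleton_iff.mpr
        ⟨a' - g • a, A.sub_mem ha' (A.smul_mem _ ha), g * X ^ e, ?_⟩
      rw [mul_smul, ← hp, ← hq, hg, smul_add]
      abel
    · exfalso
      have hed : e < d := by
        by_contra hle
        exact hmem (hpow A x' d e (not_lt.mp hle) (hd3 x' hx'))
      obtain ⟨k, rfl⟩ := Nat.exists_eq_add_of_lt hed
      have h1 : (X : K[X]) ^ (e + k) • x ∈ A := by
        have h2 : (X : K[X]) ^ (e + k) • x =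
            (X : K[X]) ^ k • (a - (X * g) • a') + g • (X : K[X]) ^ (e + k + 1) • x' := by
          have h3 : (X : K[X]) ^ (e + k + 1) • x' =
              (X : K[X]) ^ (k + 1) • (X : K[X]) ^ e • x' := by
            rw [smul_smul, ← pow_add]; congr 2; omega
          rw [h3, ← hq, add_comm e k, pow_add, mul_smul, ← hp, hg]
          simp only [smul_add, smul_sub, smul_smul]
          ring_nf
          abel
        rw [h2]
        exact A.add_mem (A.smul_mem _ (A.sub_mem ha (A.smul_mem _ ha')))
          (A.smul_mem _ (hd3 x' hx'))
      have := hd2 _ h1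
      omega
  have := finrank_sup_span_singleton_le_add (K := K) key
  omega

/-- The largest dimension of a submodule of `M` generated by `i` elements of `M` and `j` elements
of `N`. -/
noncomputable def genDim (N : Submodule K[X] M) (i j : ℕ) : ℕ :=
  sSup (Set.range fun p : (ℕ → M) × (ℕ → N) => finrank K (pairSpan p.1 p.2 i j))

variable [FiniteDimensional K M]

theorem bddAbove_finrank_pairSpan (N : Submodule K[X] M) (i j : ℕ) :
    BddAbove (Set.range fun p : (ℕ → M) × (ℕ → N) => finrank K (pairSpan p.1 p.2 i j)) := by
  refine ⟨finrank K M, ?_⟩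
  rintro _ ⟨p, rfl⟩
  rw [← finrank_polynomialModule_top (K := K) (M := M)]
  exact finrank_polynomialModule_mono le_top

theorem finrank_pairSpan_le_genDim (v : ℕ → M) (u : ℕ → N) (i j : ℕ) :
    finrank K (pairSpan v u i j) ≤ genDim N i j :=
  le_csSup (bddAbove_finrank_pairSpan N i j) ⟨(v, u), rfl⟩

theorem exists_finrank_pairSpan_eq (N : Submodule K[X] M) (i j : ℕ) :
    ∃ p : (ℕ → M) × (ℕ → N), finrank K (pairSpan p.1 p.2 i j) = genDim N i j :=
  Nat.sSup_mem (Set.range_nonempty _) (bddAbove_finrank_pairSpan N i j)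

theorem finrank_pairSpan_sup_le_left (v : ℕ → M) (u : ℕ → N) (i j : ℕ) (z : M) :
    finrank K ↥(pairSpan v u i j ⊔ Submodule.span K[X] {z}) ≤ genDim N (i + 1) j := by
  have h1 := finrank_pairSpan_le_genDim (Function.update v i z) u (i + 1) j
  have h2 : pairSpan (Function.update v i z) u i j = pairSpan v u i j := by
    rw [pairSpan, pairSpan, spanLT_congr fun k hk => Function.update_of_ne hk.ne _ _]
  rwa [pairSpan_succ_left, h2, Function.update_self] at h1

theorem finrank_pairSpan_sup_le_right (v : ℕ → M) (u : ℕ → N) (i j : ℕ) {z : M} (hz : z ∈ N) :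
    finrank K ↥(pairSpan v u i j ⊔ Submodule.span K[X] {z}) ≤ genDim N i (j + 1) := by
  have h1 := finrank_pairSpan_le_genDim v (Function.update u j ⟨z, hz⟩) i (j + 1)
  have h2 : pairSpan v (Function.update u j ⟨z, hz⟩) i j = pairSpan v u i j := by
    rw [pairSpan, pairSpan]
    congr 1
    exact spanLT_congr fun k hk => by rw [Function.update_of_ne hk.ne]
  rwa [pairSpan_succ_right, h2, Function.update_self] at h1

theorem lineOpen_le_finrank_pairSpan (N : Submodule K[X] M) (i j c : ℕ) :
    LineOpen K fun p : (ℕ → M) × (ℕ → N) => c ≤ finrank K (pairSpan p.1 p.2 i j) := by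
  set g : Fin i ⊕ Fin j → (ℕ → M) × (ℕ → N) →ₗ[K] M := Sum.elim
    (fun k => (LinearMap.proj (k : ℕ)) ∘ₗ LinearMap.fst K (ℕ → M) (ℕ → N))
    (fun k => (N.subtype.restrictScalars K) ∘ₗ (LinearMap.proj (k : ℕ)) ∘ₗ
      LinearMap.snd K (ℕ → M) (ℕ → N)) with hg
  have hspan : ∀ (y : ℕ → M) (k : ℕ),
      spanLT K y k = Submodule.span K[X] (Set.range fun a : Fin k => y a) := by
    intro y k
    rw [spanLT]
    congr 1
    ext z
    simp [Fin.exists_iff]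
  have hpair : ∀ p : (ℕ → M) × (ℕ → N), pairSpan p.1 p.2 i j =
      Submodule.span K[X] (Set.range fun t => g t p) := by
    intro p
    rw [pairSpan, hspan, hspan, ← Submodule.span_union, ← Set.Sum.elim_range]
    refine congrArg (fun f : Fin i ⊕ Fin j → M => Submodule.span K[X] (Set.range f)) (funext ?_)
    rintro (t | t) <;> rfl
  rw [show (fun p : (ℕ → M) × (ℕ → N) => c ≤ finrank K (pairSpan p.1 p.2 i j)) =
    fun p => c ≤ finrank K (Submodule.span K[X] (Set.range fun t => g t p)) from
    funext fun p => by rw [hpair p]]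
  exact lineOpen_le_finrank_span g c

/-- All the dimensions `genDim N i j` with `i, j` bounded are attained by the same vectors. -/
theorem exists_generic [Infinite K] (N : Submodule K[X] M) (n : ℕ) :
    ∃ (v : ℕ → M) (u : ℕ → N), ∀ i ≤ n, ∀ j ≤ n,
      finrank K (pairSpan v u i j) = genDim N i j := by
  obtain ⟨p, hp⟩ := exists_forall_of_lineOpen (K := K) (ι := ℕ × ℕ)
    (P := fun t (p : (ℕ → M) × (ℕ → N)) => genDim N t.1 t.2 ≤ finrank K (pairSpan p.1 p.2 t.1 t.2))
    (fun t => lineOpen_le_finrank_pairSpan N t.1 t.2 _)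
    (fun t => (exists_finrank_pairSpan_eq N t.1 t.2).imp fun _ h => h.ge)
    (Finset.range (n + 1) ×ˢ Finset.range (n + 1))
  refine ⟨p.1, p.2, fun i hi j hj => le_antisymm (finrank_pairSpan_le_genDim _ _ _ _) ?_⟩
  exact hp (i, j) (by simp; omega)

theorem genDim_le_succ_right (N : Submodule K[X] M) (i j : ℕ) :
    genDim N i j ≤ genDim N i (j + 1) := by
  obtain ⟨p, hp⟩ := exists_finrank_pairSpan_eq N i j
  rw [← hp]
  refine le_trans ?_ (finrank_pairSpan_le_genDim p.1 p.2 i (j + 1))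
  rw [pairSpan_succ_right]
  exact finrank_polynomialModule_mono le_sup_left

theorem genDim_succ_right_le (N : Submodule K[X] M) (i j : ℕ) :
    genDim N i (j + 1) ≤ genDim N (i + 1) j := by
  obtain ⟨p, hp⟩ := exists_finrank_pairSpan_eq N i (j + 1)
  rw [← hp, pairSpan_succ_right]
  exact finrank_pairSpan_sup_le_left _ _ _ _ _

theorem genDim_modular [Infinite K] (N : Submodule K[X] M) (i j : ℕ) :
    genDim N (i + 1) (j + 1) + genDim N i j ≤ genDim N (i + 1) j + genDim N i (j + 1) := by
  obtain ⟨v, u, h⟩ := exists_generic N (i + j + 1)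
  rw [← h (i + 1) (by omega) (j + 1) (by omega), ← h i (by omega) j (by omega),
    ← h (i + 1) (by omega) j (by omega), ← h i (by omega) (j + 1) (by omega),
    pairSpan_succ_right, pairSpan_succ_left, pairSpan_succ_right]
  set A := pairSpan v u i j
  have h1 := finrank_sup_add_finrank_inf_polynomialModule (K := K)
    (A ⊔ Submodule.span K[X] {v i}) (A ⊔ Submodule.span K[X] {(u j : M)})
  have h2 : finrank K A ≤ _ := finrank_polynomialModule_mono (K := K)
    (le_inf (le_sup_left : A ≤ A ⊔ Submodule.span K[X] {v i})
      (le_sup_left : A ≤ A ⊔ Submodule.span K[X] {(u j : M)}))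
  rw [sup_sup_sup_comm, sup_idem, ← sup_assoc] at h1
  omega

theorem genDim_upper [Infinite K] (hX : ∀ x : M, ∃ d, (X : K[X]) ^ d • x = 0)
    (N : Submodule K[X] M) (i j : ℕ) :
    genDim N (i + 2) j + genDim N i (j + 1) ≤
      genDim N (i + 1) (j + 1) + genDim N (i + 1) j := by
  obtain ⟨v, u, h⟩ := exists_generic N (i + j + 2)
  have e1 := h (i + 1) (by omega) (j + 1) (by omega)
  have e2 := h (i + 1) (by omega) j (by omega)
  rw [pairSpan_succ_left, pairSpan_succ_right] at e1
  rw [pairSpan_succ_left] at e2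
  rw [← h (i + 2) (by omega) j (by omega), ← h i (by omega) (j + 1) (by omega), ← e1, ← e2,
    pairSpan_succ_left, pairSpan_succ_left, pairSpan_succ_right]
  refine finrank_add_le_of_generic hX (L := ⊤) trivial (fun z _ => ?_) (fun z _ => ?_)
  · rw [e1, ← pairSpan_succ_right]
    exact finrank_pairSpan_sup_le_left _ _ _ _ _
  · rw [e2]
    exact finrank_pairSpan_sup_le_left _ _ _ _ _

theorem genDim_lower [Infinite K] (hX : ∀ x : M, ∃ d, (X : K[X]) ^ d • x = 0)
    (N : Submodule K[X] M) (i j : ℕ) :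
    genDim N i (j + 2) + genDim N (i + 1) j ≤
      genDim N (i + 1) (j + 1) + genDim N i (j + 1) := by
  obtain ⟨v, u, h⟩ := exists_generic N (i + j + 2)
  have e1 := h (i + 1) (by omega) (j + 1) (by omega)
  have e2 := h i (by omega) (j + 1) (by omega)
  rw [pairSpan_succ_right, pairSpan_succ_left] at e1
  rw [pairSpan_succ_right] at e2
  rw [← h i (by omega) (j + 2) (by omega), ← h (i + 1) (by omega) j (by omega), ← e1, ← e2,
    pairSpan_succ_right, pairSpan_succ_right, pairSpan_succ_left]
  refine finrank_add_le_of_generic hX (L := N) (u (j + 1)).2 (fun z hz => ?_) (fun z hz => ?_)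
  · rw [e1, ← pairSpan_succ_left]
    exact finrank_pairSpan_sup_le_right _ _ _ _ hz
  · rw [e2]
    exact finrank_pairSpan_sup_le_right _ _ _ _ hz

theorem finrank_sup_eq_add_finrank_map_mkQ (P N : Submodule K[X] M) :
    finrank K ↥(P ⊔ N) = finrank K N + finrank K (P.map N.mkQ) := by
  have h1 := finrank_quotient_add_finrank_polynomialModule (K := K) (P ⊔ N)
  have h2 := finrank_quotient_add_finrank_polynomialModule (K := K) N
  have h3 := finrank_quotient_add_finrank_polynomialModule (K := K) (P.map N.mkQ)
  have h4 : (P ⊔ N).map N.mkQ = P.map N.mkQ := by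
    rw [Submodule.map_sup, Submodule.mkQ_map_self, sup_bot_eq]
  have h5 := ((Submodule.quotientQuotientEquivQuotient N (P ⊔ N)
    le_sup_right).restrictScalars K).finrank_eq
  rw [h4] at h5
  omega

/-- The types of a submodule, of the module and of the quotient admit a Littlewood-Richardson
chain. -/
theorem exists_lrChain_of_hasType [Infinite K] {α β γ : YoungDiagram} (hα : HasType K N α)
    (hβ : HasType K (M ⧸ N) β) (hγ : HasType K M γ) : ∃ l, LRChain α β γ l := by
  refine exists_lrChain_of_rhombus (m := genDim N) (fun k => ?_) (fun k => ?_) (fun i j hj => ?_)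
    (genDim_le_succ_right N) (genDim_succ_right_le N) (genDim_modular N)
    (genDim_upper hγ.exists_pow_smul N) (genDim_lower hγ.exists_pow_smul N)
  · have h0 : ∀ (v : ℕ → M) (u : ℕ → N), finrank K (pairSpan v u 0 k) =
        finrank K (spanLT K u k) := by
      intro v u
      rw [pairSpan, spanLT_zero, bot_sup_eq, spanLT_coe, finrank_map_subtype_polynomialModule]
    refine le_antisymm ?_ ?_
    · obtain ⟨p, hp⟩ := exists_finrank_pairSpan_eq N 0 k
      rw [← hp, h0]
      exact hα.finrank_spanLT_le _ k
    · obtain ⟨u, hu⟩ := hα.exists_le_finrank_spanLT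
      refine (hu k).trans ?_
      rw [← h0 0 u]
      exact finrank_pairSpan_le_genDim _ _ _ _
  · have h0 : ∀ (v : ℕ → M) (u : ℕ → N), pairSpan v u k 0 = spanLT K v k := by
      intro v u
      rw [pairSpan, spanLT_zero, sup_bot_eq]
    refine le_antisymm ?_ ?_
    · obtain ⟨p, hp⟩ := exists_finrank_pairSpan_eq N k 0
      rw [← hp, h0]
      exact hγ.finrank_spanLT_le _ k
    · obtain ⟨v, hv⟩ := hγ.exists_le_finrank_spanLT
      refine (hv k).trans ?_
      rw [← h0 v 0]
      exact finrank_pairSpan_le_genDim _ _ _ _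
  · have hmap : ∀ v : ℕ → M, (spanLT K v i).map N.mkQ = spanLT K (fun k => N.mkQ (v k)) i := by
      intro v
      rw [spanLT, spanLT, Submodule.map_span, Set.image_image]
    refine le_antisymm ?_ ?_
    · obtain ⟨p, hp⟩ := exists_finrank_pairSpan_eq N i j
      have h1 : pairSpan p.1 p.2 i j ≤ spanLT K p.1 i ⊔ N :=
        sup_le_sup_left (spanLT_le fun k _ => (p.2 k).2) _
      rw [← hp, ← hα.finrank_eq]
      refine (finrank_polynomialModule_mono h1).trans ?_
      rw [finrank_sup_eq_add_finrank_map_mkQ, hmap]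
      exact Nat.add_le_add_left (hβ.finrank_spanLT_le _ i) _
    · obtain ⟨y, hy⟩ := hβ.exists_le_finrank_spanLT
      obtain ⟨u, hu1, hu2, -⟩ := id hα
      choose v hv using fun k => N.mkQ_surjective (y k)
      have h1 : pairSpan v u i j = spanLT K v i ⊔ N := by
        rw [pairSpan, spanLT_coe, spanLT_eq_top hu1 hu2
          (fun r hr => α.rowLen_eq_zero_of_card_le (hj.trans hr)), Submodule.map_top,
          Submodule.range_subtype]
      refine le_trans ?_ (finrank_pairSpan_le_genDim v u i j)
      rw [h1, finrank_sup_eq_add_finrank_map_mkQ, hmap, hα.finrank_eq]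
      rw [show (fun k => N.mkQ (v k)) = y from funext hv]
      exact Nat.add_le_add_left (hy i) _

end Hive

/-! ### Partitions and Young diagrams -/

theorem Nat.Partition.rowLens_toYoungDiagram {n : ℕ} (p : n.Partition) :
    p.toYoungDiagram.rowLens = p.parts.sort (· ≥ ·) :=
  YoungDiagram.rowLens_ofRowLens_eq_self fun _ hx => p.parts_pos ((Multiset.mem_sort _).mp hx)

theorem Nat.Partition.parts_eq_rowLens {n : ℕ} (p : n.Partition) :
    p.parts = (p.toYoungDiagram.rowLens : Multiset ℕ) := by
  rw [p.rowLens_toYoungDiagram, Multiset.sort_eq]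

theorem YoungDiagram.sum_rowLens (μ : YoungDiagram) : μ.rowLens.sum = μ.card := by
  rw [← μ.sum_rowLen (R := μ.colLen 0)]
  · rfl
  · intro r hr
    by_contra h
    have h1 : (r, 0) ∈ μ := YoungDiagram.mem_iff_lt_rowLen.mpr (Nat.pos_of_ne_zero h)
    rw [YoungDiagram.mem_iff_lt_colLen] at h1
    omega

theorem Nat.Partition.card_toYoungDiagram {n : ℕ} (p : n.Partition) :
    p.toYoungDiagram.card = n := by
  rw [← YoungDiagram.sum_rowLens, ← Multiset.sum_coe, ← p.parts_eq_rowLens, p.parts_sum]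

theorem YoungDiagram.exists_partition (μ : YoungDiagram) {n : ℕ} (h : μ.card = n) :
    ∃ p : n.Partition, p.toYoungDiagram = μ := by
  refine ⟨⟨(μ.rowLens : Multiset ℕ), fun {x} hx => μ.pos_of_mem_rowLens x hx, ?_⟩, ?_⟩
  · rw [Multiset.sum_coe, μ.sum_rowLens, h]
  · refine YoungDiagram.equivListRowLens.injective (Subtype.ext ?_)
    change YoungDiagram.rowLens _ = μ.rowLens
    rw [Nat.Partition.rowLens_toYoungDiagram]
    refine List.Perm.eq_of_pairwise (le := (· ≥ ·)) (fun a b _ _ h1 h2 => le_antisymm h2 h1)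
      (Multiset.pairwise_sort _ _) μ.rowLens_sorted.pairwise ?_
    rw [← Multiset.coe_eq_coe, Multiset.sort_eq]

theorem lrCoeff_ne_zero_iff {a b m : ℕ} (α : a.Partition) (β : b.Partition) (γ : m.Partition) :
    lrCoeff α β γ ≠ 0 ↔
      ∃ l, LRChain α.toYoungDiagram β.toYoungDiagram γ.toYoungDiagram l := by
  rw [lrCoeff, Nat.card_ne_zero, ← nonempty_lrTableau_iff]
  exact and_iff_left inferInstance

theorem iteratedLR_ne_zero_iff {r : ℕ} (n : Fin (r + 1) → ℕ) (α : ∀ i, (n i).Partition)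
    (γ : (∑ i, n i).Partition) :
    iteratedLR n α γ ≠ 0 ↔ ∃ β : ∀ k : Fin (r + 1), (∑ i ∈ Finset.Iic k, n i).Partition,
      (β 0).parts = (α 0).parts ∧ (β (Fin.last r)).parts = γ.parts ∧
        ∀ k : Fin r, lrCoeff (β k.castSucc) (α k.succ) (β k.succ) ≠ 0 := by
  rw [iteratedLR, Ne, Finset.sum_eq_zero_iff]
  simp only [Finset.mem_filter, Finset.mem_univ, true_and, not_forall, exists_prop,
    Finset.prod_eq_zero_iff, not_exists, and_assoc, Ne]

/-! ### The action of `X` in a basis -/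

section Action

open Module (finrank Basis)

variable {M : Type*} [AddCommGroup M] [Module ℂ M] [Module ℂ[X] M] [IsScalarTower ℂ ℂ[X] M]
  {ι κ : Type*} [Fintype ι] [DecidableEq ι] [Fintype κ] [DecidableEq κ]

/-- The matrix of the multiplication by `X` in a basis. -/
noncomputable def actionMatrix (b : Basis ι ℂ M) : Matrix ι ι ℂ :=
  LinearMap.toMatrix b b ((smulX ℂ M).restrictScalars ℂ)

theorem actionMatrix_apply (b : Basis ι ℂ M) (i j : ι) :
    actionMatrix b i j = b.repr ((X : ℂ[X]) • b j) i :=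
  LinearMap.toMatrix_apply _ _ _ _ _

theorem X_smul_eq_sum (b : Basis ι ℂ M) (j : ι) :
    (X : ℂ[X]) • b j = ∑ i, actionMatrix b i j • b i := by
  simp only [actionMatrix_apply]
  exact (b.sum_repr _).symm

theorem actionMatrix_eq {b : Basis ι ℂ M} {A : Matrix ι ι ℂ}
    (h : ∀ j, (X : ℂ[X]) • b j = ∑ i, A i j • b i) : actionMatrix b = A := by
  ext i j
  rw [actionMatrix_apply, h, b.repr_sum_self]

theorem actionMatrix_reindex (b : Basis ι ℂ M) (e : ι ≃ κ) :
    actionMatrix (b.reindex e) = (actionMatrix b).submatrix e.symm e.symm := by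
  ext i j
  simp [actionMatrix_apply]

/-- The module in which `X` acts by a given matrix. -/
abbrev MatrixModule {N : ℕ} (A : Matrix (Fin N) (Fin N) ℂ) : Type :=
  Module.AEval' (Matrix.toLin' A)

theorem exists_basis_matrixModule {N : ℕ} (A : Matrix (Fin N) (Fin N) ℂ) :
    ∃ b : Basis (Fin N) ℂ (MatrixModule A), actionMatrix b = A := by
  refine ⟨(Pi.basisFun ℂ (Fin N)).map (Module.AEval'.of (Matrix.toLin' A)), ?_⟩
  ext i j
  rw [actionMatrix_apply, Basis.map_apply, Module.AEval'.X_smul_of]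
  simp

/-- Matrices conjugate to `A` are the matrices of `X`, in all the bases, in the module where `X`
acts by `A` in some basis. -/
theorem mem_adjointSaturation_iff {N : ℕ} (b : Basis (Fin N) ℂ M)
    (S : Set (Matrix (Fin N) (Fin N) ℂ)) :
    actionMatrix b ∈ adjointSaturation S ↔
      ∃ c : Basis (Fin N) ℂ M, actionMatrix c ∈ S := by
  constructor
  · rintro ⟨g, Y, hY, h⟩
    have hg : ((g⁻¹ : GL (Fin N) ℂ) : Matrix (Fin N) (Fin N) ℂ) *
        (g : Matrix (Fin N) (Fin N) ℂ) = 1 := g.inv_mul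
    have hg' : (g : Matrix (Fin N) (Fin N) ℂ) *
        ((g⁻¹ : GL (Fin N) ℂ) : Matrix (Fin N) (Fin N) ℂ) = 1 := g.mul_inv
    let e : M ≃ₗ[ℂ] M := LinearEquiv.ofLinearMap
      (Matrix.toLin b b (g : Matrix (Fin N) (Fin N) ℂ))
      (Matrix.toLin b b ((g⁻¹ : GL (Fin N) ℂ) : Matrix (Fin N) (Fin N) ℂ))
      (by rw [← Matrix.toLin_mul, hg', Matrix.toLin_one])
      (by rw [← Matrix.toLin_mul, hg, Matrix.toLin_one])
    refine ⟨b.map e, ?_⟩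
    have h1 : actionMatrix (b.map e) =
        LinearMap.toMatrix b b
          (Matrix.toLin b b ((g⁻¹ : GL (Fin N) ℂ) : Matrix (Fin N) (Fin N) ℂ) ∘ₗ
          (smulX ℂ M).restrictScalars ℂ ∘ₗ
            Matrix.toLin b b (g : Matrix (Fin N) (Fin N) ℂ)) := by
      ext i j
      rw [actionMatrix_apply, LinearMap.toMatrix_apply]
      rfl
    rw [h1, LinearMap.toMatrix_comp b b b, LinearMap.toMatrix_comp b b b, LinearMap.toMatrix_toLin,
      LinearMap.toMatrix_toLin]
    change _ * (actionMatrix b * _) ∈ S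
    rw [h, Matrix.mul_assoc, hg, Matrix.mul_one, ← Matrix.mul_assoc, hg, Matrix.one_mul]
    exact hY
  · rintro ⟨c, hc⟩
    refine ⟨⟨b.toMatrix c, c.toMatrix b, b.toMatrix_mul_toMatrix_flip c,
      c.toMatrix_mul_toMatrix_flip b⟩, _, hc, ?_⟩
    exact (basis_toMatrix_mul_linearMap_toMatrix_mul_basis_toMatrix b c b c _).symm

theorem map_smul_of_map_X_smul {M' : Type*} [AddCommGroup M'] [Module ℂ M'] [Module ℂ[X] M']
    [IsScalarTower ℂ ℂ[X] M'] (f : M →ₗ[ℂ] M')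
    (hf : ∀ z, f ((X : ℂ[X]) • z) = (X : ℂ[X]) • f z) (p : ℂ[X]) (z : M) :
    f (p • z) = p • f z := by
  induction p using Polynomial.induction_on' with
  | add p q hp hq => rw [add_smul, add_smul, map_add, hp, hq]
  | monomial n a =>
    rw [← Polynomial.C_mul_X_pow_eq_monomial, ← Polynomial.smul_eq_C_mul, smul_assoc, smul_assoc,
      map_smul]
    congr 1
    induction n with
    | zero => simp
    | succ n ih => rw [pow_succ', mul_smul, mul_smul, hf, ih]

end Action

/-! ### Jordan bases -/

section Jordan

open Module (finrank Basis)

/-- A subspace stable under `X`, as a `K[X]`-submodule. -/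
def Submodule.ofXStable {K M : Type*} [Field K] [AddCommGroup M] [Module K M] [Module K[X] M]
    [IsScalarTower K K[X] M] (W : Submodule K M) (hW : ∀ z ∈ W, (X : K[X]) • z ∈ W) :
    Submodule K[X] M where
  __ := W
  smul_mem' p z hz := by
    induction p using Polynomial.induction_on' with
    | add p q hp hq => rw [add_smul]; exact W.add_mem hp hq
    | monomial n a =>
      rw [← Polynomial.C_mul_X_pow_eq_monomial, ← Polynomial.smul_eq_C_mul, smul_assoc]
      refine W.smul_mem a ?_
      induction n with
      | zero => rw [pow_zero, one_smul]; exact hz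
      | succ n ih => rw [pow_succ', mul_smul]; exact hW _ ih

variable {M : Type*} [AddCommGroup M] [Module ℂ M]

theorem sum_jordanMatrix_smul_zero {μ : YoungDiagram} (b : μ.cells → M) {r : ℕ}
    (h : (r, 0) ∈ μ.cells) : ∑ c, jordanMatrix μ c ⟨(r, 0), h⟩ • b c = 0 := by
  refine Finset.sum_eq_zero fun c _ => ?_
  rw [jordanMatrix, if_neg, zero_smul]
  rintro ⟨-, h⟩
  simp at h

theorem sum_jordanMatrix_smul_succ {μ : YoungDiagram} (b : μ.cells → M) {r k : ℕ}
    (h : (r, k + 1) ∈ μ.cells) (h' : (r, k) ∈ μ.cells) :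
    ∑ c, jordanMatrix μ c ⟨(r, k + 1), h⟩ • b c = b ⟨(r, k), h'⟩ := by
  rw [Finset.sum_eq_single ⟨(r, k), h'⟩]
  · simp [jordanMatrix]
  · rintro ⟨⟨x, y⟩, hc⟩ _ hne
    rw [jordanMatrix, if_neg, zero_smul]
    rintro ⟨h1, h2⟩
    dsimp only at h1 h2
    subst h1
    obtain rfl : k = y := by omega
    exact hne rfl
  · exact fun h => absurd (Finset.mem_univ _) h

variable [Module ℂ[X] M] [IsScalarTower ℂ ℂ[X] M]

theorem YoungDiagram.mem_cells_of_succ {μ : YoungDiagram} {r k : ℕ} (h : (r, k + 1) ∈ μ.cells) :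
    (r, k) ∈ μ.cells :=
  μ.up_left_mem le_rfl (Nat.le_succ k) h

/-- A module is of type `μ` if and only if `X` acts by the Jordan matrix of `μ` in some basis. -/
theorem hasType_iff_exists_basis {μ : YoungDiagram} :
    HasType ℂ M μ ↔ ∃ b : Basis μ.cells ℂ M, actionMatrix b = jordanMatrix μ := by
  constructor
  · rintro ⟨x, h1, h2, h3⟩
    set b : μ.cells → M := fun d => (X : ℂ[X]) ^ (μ.rowLen d.1.1 - 1 - d.1.2) • x d.1.1 with hb
    have hlt : ∀ d : μ.cells, d.1.2 < μ.rowLen d.1.1 := fun d =>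
      YoungDiagram.mem_iff_lt_rowLen.mp d.2
    have hX : ∀ d, (X : ℂ[X]) • b d = ∑ c, jordanMatrix μ c d • b c := by
      rintro ⟨⟨r, k⟩, hd⟩
      have := hlt ⟨(r, k), hd⟩
      dsimp only at this
      rcases k with _ | k
      · rw [sum_jordanMatrix_smul_zero, hb, smul_smul, ← pow_succ', ← h1 r]
        congr 2
        dsimp only
        omega
      · rw [sum_jordanMatrix_smul_succ b hd (YoungDiagram.mem_cells_of_succ hd), hb, smul_smul,
          ← pow_succ']
        congr 2
        dsimp only
        omega
    set W := (Submodule.span ℂ (Set.range b)).ofXStable (by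
      intro z hz
      induction hz using Submodule.span_induction with
      | mem z hz =>
        obtain ⟨d, rfl⟩ := hz
        rw [hX]
        exact Submodule.sum_mem _ fun c _ => Submodule.smul_mem _ _ (Submodule.subset_span ⟨c, rfl⟩)
      | zero => rw [smul_zero]; exact Submodule.zero_mem _
      | add y z _ _ hy hz => rw [smul_add]; exact Submodule.add_mem _ hy hz
      | smul a z _ hz => rw [smul_comm]; exact Submodule.smul_mem _ _ hz) with hW
    have hWtop : W = ⊤ := by
      rw [eq_top_iff, ← h2, Submodule.span_le]
      rintro _ ⟨r, rfl⟩
      rcases Nat.eq_zero_or_pos (μ.rowLen r) with h0 | h0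
      · have := h1 r
        rw [h0, pow_zero, one_smul] at this
        rw [this]
        exact W.zero_mem
      · have hmem : (r, μ.rowLen r - 1) ∈ μ.cells :=
          YoungDiagram.mem_iff_lt_rowLen.mpr (by omega)
        have : b ⟨_, hmem⟩ = x r := by simp [hb]
        rw [← this]
        exact Submodule.subset_span (s := Set.range b) ⟨_, rfl⟩
    have hspan : ⊤ ≤ Submodule.span ℂ (Set.range b) := fun z _ => by
      have : z ∈ W := hWtop ▸ Submodule.mem_top
      exact this
    refine ⟨basisOfTopLeSpanOfCardEqFinrank b hspan ?_, actionMatrix_eq fun j => ?_⟩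
    · rw [h3, Fintype.card_coe]
    · rw [coe_basisOfTopLeSpanOfCardEqFinrank]
      exact hX j
  · rintro ⟨b, hb⟩
    have hX : ∀ d, (X : ℂ[X]) • b d = ∑ c, jordanMatrix μ c d • b c := by
      intro d
      rw [X_smul_eq_sum, hb]
    have hpow : ∀ (k m r : ℕ) (h : (r, k + m) ∈ μ.cells) (h' : (r, k) ∈ μ.cells),
        (X : ℂ[X]) ^ m • b ⟨(r, k + m), h⟩ = b ⟨(r, k), h'⟩ := by
      intro k m r
      induction m with
      | zero => intro h h'; rw [pow_zero, one_smul]; rfl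
      | succ m ih =>
        intro h h'
        have h'' := YoungDiagram.mem_cells_of_succ (k := k + m) h
        rw [pow_succ, mul_smul, hX]
        exact (congrArg _ (sum_jordanMatrix_smul_succ b (k := k + m) h h'')).trans (ih h'' h')
    have hlast : ∀ r, 0 < μ.rowLen r → (r, μ.rowLen r - 1) ∈ μ.cells := fun r hr =>
      YoungDiagram.mem_iff_lt_rowLen.mpr (by omega)
    set x : ℕ → M := fun r => if hr : 0 < μ.rowLen r then b ⟨_, hlast r hr⟩ else 0 with hx
    refine ⟨x, fun r => ?_, ?_, ?_⟩
    · rw [hx]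
      dsimp only
      split_ifs with hr
      · obtain ⟨m, hm⟩ : ∃ m, μ.rowLen r = m + 1 := ⟨μ.rowLen r - 1, by omega⟩
        have h0 : (r, 0) ∈ μ.cells := YoungDiagram.mem_iff_lt_rowLen.mpr hr
        have hlast' : (r, 0 + m) ∈ μ.cells := YoungDiagram.mem_iff_lt_rowLen.mpr (by omega)
        have h1 : b ⟨_, hlast r hr⟩ = b ⟨(r, 0 + m), hlast'⟩ := by
          congr 2
          rw [hm]
          simp
        rw [h1, hm, pow_succ', mul_smul, hpow 0 m r hlast' h0, hX, sum_jordanMatrix_smul_zero]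
      · exact smul_zero _
    · rw [eq_top_iff]
      intro z _
      have hz : z ∈ Submodule.span ℂ (Set.range b) := by rw [b.span_eq]; trivial
      refine (Submodule.span_le (p := (Submodule.span ℂ[X] (Set.range x)).restrictScalars ℂ)).mpr
        ?_ hz
      rintro _ ⟨⟨⟨r, k⟩, hd⟩, rfl⟩
      have hk : k < μ.rowLen r := YoungDiagram.mem_iff_lt_rowLen.mp hd
      obtain ⟨m, hm⟩ : ∃ m, μ.rowLen r - 1 = k + m := ⟨μ.rowLen r - 1 - k, by omega⟩
      have hlast' : (r, k + m) ∈ μ.cells := YoungDiagram.mem_iff_lt_rowLen.mpr (by omega)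
      have h1 : b ⟨_, hlast r (by omega)⟩ = b ⟨(r, k + m), hlast'⟩ := by
        congr 2
        rw [hm]
      rw [← hpow k m r hlast' hd, ← h1]
      have hxr : x r = b ⟨_, hlast r (by omega)⟩ := dif_pos (by omega)
      exact Submodule.smul_mem (Submodule.span ℂ[X] (Set.range x)) _
        (Submodule.subset_span ⟨r, hxr⟩)
    · rw [Module.finrank_eq_card_basis b, Fintype.card_coe]

/-- The orbit `O_α` consists of the matrices of `X` in the modules of type `α`. -/
theorem actionMatrix_mem_nilpotentOrbit_iff {N : ℕ} (α : N.Partition) (b : Basis (Fin N) ℂ M) :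
    actionMatrix b ∈ nilpotentOrbit α ↔ HasType ℂ M α.toYoungDiagram := by
  rw [nilpotentOrbit, mem_adjointSaturation_iff, hasType_iff_exists_basis]
  constructor
  · rintro ⟨c, e, hc⟩
    refine ⟨c.reindex e, ?_⟩
    rw [actionMatrix_reindex, hc, Matrix.submatrix_submatrix]
    simp
  · rintro ⟨c, hc⟩
    have e : Fin N ≃ α.toYoungDiagram.cells := Fintype.equivOfCardEq (by
      rw [Fintype.card_fin, Fintype.card_coe]
      exact α.card_toYoungDiagram.symm)
    refine ⟨c.reindex e.symm, e, ?_⟩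
    rw [actionMatrix_reindex, hc]
    rfl

theorem mem_nilpotentOrbit_iff {N : ℕ} (α : N.Partition) (A : Matrix (Fin N) (Fin N) ℂ) :
    A ∈ nilpotentOrbit α ↔ HasType ℂ (MatrixModule A) α.toYoungDiagram := by
  obtain ⟨b, hb⟩ := exists_basis_matrixModule A
  rw [← actionMatrix_mem_nilpotentOrbit_iff α b, hb]

theorem nilpotentOrbit_nonempty {N : ℕ} (α : N.Partition) : (nilpotentOrbit α).Nonempty := by
  have e : Fin N ≃ α.toYoungDiagram.cells := Fintype.equivOfCardEq (by
    rw [Fintype.card_fin, Fintype.card_coe]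
    exact α.card_toYoungDiagram.symm)
  exact ⟨_, 1, _, ⟨e, rfl⟩, rfl⟩

end Jordan

/-! ### Block triangular matrices and flags -/

section Flag

open Module (finrank Basis)

variable {M : Type*} [AddCommGroup M] [Module ℂ M] [Module ℂ[X] M] [IsScalarTower ℂ ℂ[X] M]
  {s : ℕ} {n : Fin s → ℕ}

/-- Matrices, with rows and columns numbered by blocks, that are block upper triangular with
diagonal blocks in the orbits `O_{α_i}`. -/
def IsBlockTriangular (α : ∀ i, (n i).Partition)
    (T : Matrix (Σ i, Fin (n i)) (Σ i, Fin (n i)) ℂ) : Prop :=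
  (∀ i j a c, j < i → T ⟨i, a⟩ ⟨j, c⟩ = 0) ∧
    ∀ j, (Matrix.of fun a c => T ⟨j, a⟩ ⟨j, c⟩) ∈ nilpotentOrbit (α j)

theorem mem_leviOrbit_add_parabolicNilradical_iff (α : ∀ i, (n i).Partition)
    (Y : Matrix (Fin (∑ i, n i)) (Fin (∑ i, n i)) ℂ) :
    Y ∈ leviOrbit n α +
        (parabolicNilradical n : Set (Matrix (Fin (∑ i, n i)) (Fin (∑ i, n i)) ℂ)) ↔
      IsBlockTriangular α (Y.submatrix finSigmaFinEquiv finSigmaFinEquiv) := by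
  have hdiag : ∀ (A : ∀ i, Matrix (Fin (n i)) (Fin (n i)) ℂ) (i : Fin s) (a c : Fin (n i)),
      Matrix.reindex finSigmaFinEquiv finSigmaFinEquiv (Matrix.blockDiagonal' A)
        (finSigmaFinEquiv ⟨i, a⟩) (finSigmaFinEquiv ⟨i, c⟩) = A i a c := by
    intro A i a c
    simp [Matrix.blockDiagonal'_apply]
  have hoff : ∀ (A : ∀ i, Matrix (Fin (n i)) (Fin (n i)) ℂ) (i j : Fin s) (a : Fin (n i))
      (c : Fin (n j)), i ≠ j →
      Matrix.reindex finSigmaFinEquiv finSigmaFinEquiv (Matrix.blockDiagonal' A)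
        (finSigmaFinEquiv ⟨i, a⟩) (finSigmaFinEquiv ⟨j, c⟩) = 0 := by
    intro A i j a c hij
    simp [Matrix.blockDiagonal'_apply, hij]
  constructor
  · rintro ⟨L, ⟨A, hA, rfl⟩, P, hP, rfl⟩
    refine ⟨fun i j a c hij => ?_, fun j => ?_⟩
    · change Matrix.reindex finSigmaFinEquiv finSigmaFinEquiv (Matrix.blockDiagonal' A) _ _ +
        P _ _ = _
      rw [hoff A i j a c hij.ne', hP i j a c hij.le,
        add_zero]
    · convert hA j using 1
      ext a c
      change Matrix.reindex finSigmaFinEquiv finSigmaFinEquiv (Matrix.blockDiagonal' A) _ _ +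
        P _ _ = _
      rw [hdiag, hP j j a c le_rfl,
        add_zero]
  · rintro ⟨h1, h2⟩
    refine ⟨_, ⟨fun j => Matrix.of fun a c => Y.submatrix finSigmaFinEquiv finSigmaFinEquiv
      ⟨j, a⟩ ⟨j, c⟩, h2, rfl⟩, _, ?_, add_sub_cancel _ _⟩
    intro i j a c hij
    rw [Matrix.sub_apply]
    rcases hij.eq_or_lt with rfl | hij
    · rw [hdiag, Matrix.of_apply, Matrix.submatrix_apply, sub_self]
    · rw [hoff _ i j a c hij.ne', sub_zero]
      exact h1 i j a c hij

/-- A flag of submodules whose successive quotients have the types `α`. -/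
structure IsTypedFlag (α : ∀ i, (n i).Partition) (W : Fin (s + 1) → Submodule ℂ[X] M) : Prop where
  zero : W 0 = ⊥
  last : W (Fin.last s) = ⊤
  le : ∀ j : Fin s, W j.castSucc ≤ W j.succ
  hasType : ∀ j : Fin s,
    HasType ℂ (↥(W j.succ) ⧸ (W j.castSucc).submoduleOf (W j.succ)) (α j).toYoungDiagram

theorem exists_isTypedFlag_of_basis {α : ∀ i, (n i).Partition} {b : Basis (Σ i, Fin (n i)) ℂ M}
    (hb : IsBlockTriangular α (actionMatrix b)) :
    ∃ W : Fin (s + 1) → Submodule ℂ[X] M, IsTypedFlag α W := by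
  obtain ⟨hT, hA⟩ := hb
  have hrepr : ∀ z x, b.repr ((X : ℂ[X]) • z) x = ∑ y, actionMatrix b x y * b.repr z y :=
    fun z x => (congrFun (LinearMap.toMatrix_mulVec_repr b b
      ((smulX ℂ M).restrictScalars ℂ) z) x).symm
  set W : Fin (s + 1) → Submodule ℂ[X] M := fun k => Submodule.ofXStable
    (⨅ x : Σ i, Fin (n i), ⨅ _ : k.val ≤ x.1.val, LinearMap.ker (b.coord x)) (by
      intro z hz
      simp only [Submodule.mem_iInf, LinearMap.mem_ker, Basis.coord_apply] at hz ⊢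
      intro x hx
      rw [hrepr]
      refine Finset.sum_eq_zero fun y _ => ?_
      rcases lt_or_ge y.1.val k.val with h | h
      · rw [hT x.1 y.1 x.2 y.2 (Fin.lt_def.mpr (h.trans_le hx)), zero_mul]
      · rw [hz y h, mul_zero]) with hW
  have hmem : ∀ k z, z ∈ W k ↔ ∀ x : Σ i, Fin (n i), k.val ≤ x.1.val → b.repr z x = 0 := by
    intro k z
    change z ∈ (⨅ x : Σ i, Fin (n i), ⨅ _ : k.val ≤ x.1.val, LinearMap.ker (b.coord x)) ↔ _
    simp only [Submodule.mem_iInf, LinearMap.mem_ker, Basis.coord_apply]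
  refine ⟨W, ?_, ?_, ?_, ?_⟩
  · rw [eq_bot_iff]
    intro z hz
    rw [Submodule.mem_bot, ← b.repr.map_eq_zero_iff]
    ext x
    exact (hmem 0 z).mp hz x (Nat.zero_le _)
  · rw [eq_top_iff]
    intro z _
    rw [hmem]
    intro x hx
    exact absurd x.1.2 (not_lt.mpr hx)
  · intro j z hz
    rw [hmem] at hz ⊢
    exact fun x hx => hz x ((Nat.le_succ _).trans hx)
  · intro j
    set A : Matrix (Fin (n j)) (Fin (n j)) ℂ :=
      Matrix.of fun a c => actionMatrix b ⟨j, a⟩ ⟨j, c⟩ with hAdef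
    -- the coordinates of the block `j`
    set f : ↥(W j.succ) →ₗ[ℂ] MatrixModule A :=
      (Module.AEval'.of (Matrix.toLin' A)).toLinearMap ∘ₗ
        (LinearMap.pi fun a => b.coord ⟨j, a⟩) ∘ₗ (W j.succ).subtype.restrictScalars ℂ with hf
    have hfapp : ∀ z, f z = Module.AEval'.of (Matrix.toLin' A)
        (fun a => b.repr (z : M) ⟨j, a⟩) := fun z => rfl
    have hfX : ∀ z, f ((X : ℂ[X]) • z) = (X : ℂ[X]) • f z := by
      intro z
      rw [hfapp, hfapp, Module.AEval'.X_smul_of]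
      congr 1
      funext a
      rw [Submodule.coe_smul, hrepr, Fintype.sum_sigma, Finset.sum_eq_single j]
      · rfl
      · intro i _ hij
        refine Finset.sum_eq_zero fun c _ => ?_
        rcases lt_or_gt_of_ne hij with h | h
        · rw [hT j i a c h, zero_mul]
        · rw [(hmem j.succ z).mp z.2 ⟨i, c⟩ (Fin.lt_def.mp h), mul_zero]
      · exact fun h => absurd (Finset.mem_univ _) h
    let φ : ↥(W j.succ) →ₗ[ℂ[X]] MatrixModule A :=
      { f with map_smul' := map_smul_of_map_X_smul f hfX }
    have hφ : ∀ z, φ z = f z := fun z => rfl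
    have hker : LinearMap.ker φ = (W j.castSucc).submoduleOf (W j.succ) := by
      ext z
      rw [LinearMap.mem_ker, hφ, hfapp, LinearEquiv.map_eq_zero_iff, Submodule.submoduleOf,
        Submodule.mem_comap, hmem]
      constructor
      · intro h x hx
        rcases eq_or_ne x.1 j with h1 | h1
        · obtain ⟨i, a⟩ := x
          subst h1
          exact congrFun h a
        · refine (hmem j.succ z).mp z.2 x ?_
          have h2 : j.val ≤ x.1.val := hx
          have h3 : x.1.val ≠ j.val := fun h => h1 (Fin.ext h)
          rw [Fin.val_succ]
          omega
      · intro h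
        funext a
        exact h ⟨j, a⟩ le_rfl
    have hsurj : Function.Surjective φ := by
      intro v
      obtain ⟨v, rfl⟩ := (Module.AEval'.of (Matrix.toLin' A)).surjective v
      have hz : ∀ x, b.repr (∑ a, v a • b ⟨j, a⟩) x =
          ∑ a, v a * (if (⟨j, a⟩ : Σ i, Fin (n i)) = x then 1 else 0) := by
        intro x
        simp [map_sum, Finsupp.single_apply]
      refine ⟨⟨∑ a, v a • b ⟨j, a⟩, (hmem _ _).mpr fun x hx => ?_⟩, ?_⟩
      · rw [hz]
        refine Finset.sum_eq_zero fun a _ => ?_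
        rw [if_neg, mul_zero]
        rintro rfl
        exact absurd (show j.val + 1 ≤ j.val from hx) (by omega)
      · rw [hφ, hfapp]
        congr 1
        funext a
        dsimp only
        rw [hz]
        simp
    exact ((mem_nilpotentOrbit_iff (α j) A).mp (hA j)).of_equiv
      ((Submodule.quotEquivOfEq _ _ hker.symm).trans
        (φ.quotKerEquivOfSurjective hsurj)).symm

/-- A basis of the quotient of two consecutive submodules, lifted. -/
theorem HasType.exists_lift [FiniteDimensional ℂ M] {m : ℕ} {α : m.Partition}
    {Q P : Submodule ℂ[X] M} (h : HasType ℂ (↥P ⧸ Q.submoduleOf P) α.toYoungDiagram) :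
    ∃ A ∈ nilpotentOrbit α, ∃ c : Fin m → M,
      (∀ a, (X : ℂ[X]) • c a - ∑ a', A a' a • c a' ∈ Q) ∧
        ∀ z ∈ P, ∃ t : Fin m → ℂ, z - ∑ a, t a • c a ∈ Q := by
  have hm : finrank ℂ (↥P ⧸ Q.submoduleOf P) = m := by
    rw [h.finrank_eq, α.card_toYoungDiagram]
  set b := Module.finBasisOfFinrankEq ℂ (↥P ⧸ Q.submoduleOf P) hm
  refine ⟨actionMatrix b, (actionMatrix_mem_nilpotentOrbit_iff α b).mpr h, ?_⟩
  choose c hc using fun a => Submodule.mkQ_surjective (Q.submoduleOf P) (b a)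
  have hQ : ∀ z : P, (Q.submoduleOf P).mkQ z = 0 ↔ (z : M) ∈ Q := by
    intro z
    rw [Submodule.mkQ_apply, Submodule.Quotient.mk_eq_zero]
    rfl
  have hlin : ∀ t : Fin m → ℂ, (Q.submoduleOf P).mkQ (∑ a, t a • c a) = ∑ a, t a • b a := by
    intro t
    rw [map_sum]
    refine Finset.sum_congr rfl fun a _ => ?_
    rw [← hc a]
    rfl
  have hcoe : ∀ t : Fin m → ℂ, ((∑ a, t a • c a : P) : M) = ∑ a, t a • (c a : M) := by
    intro t
    rw [Submodule.coe_sum]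
    rfl
  refine ⟨fun a => c a, fun a => ?_, fun z hz => ⟨b.repr ((Q.submoduleOf P).mkQ ⟨z, hz⟩), ?_⟩⟩
  · have h1 := (hQ ((X : ℂ[X]) • c a - ∑ a', actionMatrix b a' a • c a')).mp (by
      rw [map_sub, map_smul, hlin, hc, X_smul_eq_sum, sub_self])
    rwa [Submodule.coe_sub, hcoe] at h1
  · have h1 := (hQ (⟨z, hz⟩ - ∑ a, b.repr ((Q.submoduleOf P).mkQ ⟨z, hz⟩) a • c a)).mp (by
      rw [map_sub, hlin, b.sum_repr, sub_self])
    rwa [Submodule.coe_sub, hcoe] at h1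

theorem IsTypedFlag.exists_basis [FiniteDimensional ℂ M] {α : ∀ i, (n i).Partition}
    {W : Fin (s + 1) → Submodule ℂ[X] M} (hW : IsTypedFlag α W)
    (hdim : finrank ℂ M = ∑ i, n i) :
    ∃ b : Basis (Σ i, Fin (n i)) ℂ M, IsBlockTriangular α (actionMatrix b) := by
  choose A hA c hc1 hc2 using fun j => (hW.hasType j).exists_lift
  set v : (Σ i, Fin (n i)) → M := fun x => c x.1 x.2 with hv
  have hspan : ∀ k, ∀ z ∈ W k, z ∈ Submodule.span ℂ (v '' {x | x.1.val < k.val}) := by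
    intro k
    induction k using Fin.induction with
    | zero =>
      intro z hz
      rw [hW.zero, Submodule.mem_bot] at hz
      rw [hz]
      exact Submodule.zero_mem _
    | succ j ih =>
      intro z hz
      obtain ⟨t, ht⟩ := hc2 j z hz
      rw [← sub_add_cancel z (∑ a, t a • c j a)]
      refine Submodule.add_mem _ ?_ ?_
      · refine Submodule.span_mono (Set.image_mono ?_) (ih _ ht)
        intro x hx
        exact lt_trans (b := j.val) hx (Nat.lt_succ_self _)
      · refine Submodule.sum_mem _ fun a _ => Submodule.smul_mem _ _ (Submodule.subset_span ?_)
        exact ⟨⟨j, a⟩, Nat.lt_succ_self _, rfl⟩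
  have htop : ⊤ ≤ Submodule.span ℂ (Set.range v) := by
    intro z _
    refine Submodule.span_mono (Set.image_subset_range _ _) (hspan (Fin.last s) z ?_)
    rw [hW.last]
    trivial
  set b := basisOfTopLeSpanOfCardEqFinrank v htop (by simp [hdim]) with hbdef
  have hb : ∀ x, b x = v x := fun x => by rw [hbdef, coe_basisOfTopLeSpanOfCardEqFinrank]
  have hbv : (b : (Σ i, Fin (n i)) → M) = v := funext hb
  have hlow : ∀ (j : Fin s) (z : M), z ∈ W j.castSucc → ∀ x : Σ i, Fin (n i), j ≤ x.1 →
      b.repr z x = 0 := by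
    intro j z hz x hx
    have h1 := hspan _ z hz
    rw [← hbv, b.mem_span_image] at h1
    by_contra hne
    have h2 : x.1.val < j.val := h1 (Finsupp.mem_support_iff.mpr hne)
    exact absurd h2 (not_lt.mpr hx)
  -- the matrix of `X` below and on the diagonal blocks
  have hT : ∀ (i j : Fin s) (a : Fin (n i)) (d : Fin (n j)), j ≤ i →
      actionMatrix b ⟨i, a⟩ ⟨j, d⟩ =
        ∑ a', A j a' d * (if (⟨j, a'⟩ : Σ i, Fin (n i)) = ⟨i, a⟩ then 1 else 0) := by
    intro i j a d hij
    have h1 := hlow j _ (hc1 j d) ⟨i, a⟩ hij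
    rw [map_sub, Finsupp.sub_apply, sub_eq_zero] at h1
    rw [actionMatrix_apply, hb, h1, map_sum, Finsupp.finsetSum_apply]
    refine Finset.sum_congr rfl fun a' _ => ?_
    have h2 : c j a' = b ⟨j, a'⟩ := (hb ⟨j, a'⟩).symm
    rw [h2, map_smul, b.repr_self, Finsupp.smul_apply, Finsupp.single_apply, smul_eq_mul]
  refine ⟨b, fun i j a d hij => ?_, fun j => ?_⟩
  · rw [hT i j a d hij.le]
    refine Finset.sum_eq_zero fun a' _ => ?_
    rw [if_neg, mul_zero]
    intro h
    exact hij.ne (congrArg Sigma.fst h)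
  · convert hA j using 1
    ext a d
    rw [Matrix.of_apply, hT j j a d le_rfl]
    simp

/-- The matrices conjugate to an element of `∏ O_{α_i} + 𝔫` are those whose module has a flag with
quotients of types `α_i`. -/
theorem mem_adjointSaturation_leviOrbit_iff (α : ∀ i, (n i).Partition)
    (Y : Matrix (Fin (∑ i, n i)) (Fin (∑ i, n i)) ℂ) :
    Y ∈ adjointSaturation (leviOrbit n α +
        (parabolicNilradical n : Set (Matrix (Fin (∑ i, n i)) (Fin (∑ i, n i)) ℂ))) ↔
      ∃ W : Fin (s + 1) → Submodule ℂ[X] (MatrixModule Y), IsTypedFlag α W := by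
  obtain ⟨b, hb⟩ := exists_basis_matrixModule Y
  have key := mem_adjointSaturation_iff b (leviOrbit n α +
    (parabolicNilradical n : Set (Matrix (Fin (∑ i, n i)) (Fin (∑ i, n i)) ℂ)))
  rw [hb] at key
  rw [key]
  constructor
  · rintro ⟨c, hc⟩
    refine exists_isTypedFlag_of_basis (b := c.reindex finSigmaFinEquiv.symm) ?_
    rw [actionMatrix_reindex]
    exact (mem_leviOrbit_add_parabolicNilradical_iff α _).mp hc
  · rintro ⟨W, hW⟩
    obtain ⟨c, hc⟩ := hW.exists_basis (by rw [Module.finrank_eq_card_basis b, Fintype.card_fin])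
    refine ⟨c.reindex finSigmaFinEquiv,
      (mem_leviOrbit_add_parabolicNilradical_iff α _).mpr ?_⟩
    rw [actionMatrix_reindex, Matrix.submatrix_submatrix]
    simpa using hc

end Flag

/-! ### Flags and iterated Littlewood-Richardson coefficients -/

section IteratedFlag

open Module (finrank)

variable {M : Type*} [AddCommGroup M] [Module ℂ M] [Module ℂ[X] M] [IsScalarTower ℂ ℂ[X] M]
  [FiniteDimensional ℂ M] {r : ℕ} {n : Fin (r + 1) → ℕ}

theorem Fin.Iic_succ_eq_insert (k : Fin r) :
    Finset.Iic k.succ = insert k.succ (Finset.Iic k.castSucc) := by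
  ext i
  simp only [Finset.mem_Iic, Finset.mem_insert, Fin.le_def, Fin.ext_iff, Fin.val_succ,
    Fin.val_castSucc]
  omega

/-- The types of the members of a flag form a family with nonzero Littlewood-Richardson
coefficients. -/
theorem IsTypedFlag.exists_partitions {α : ∀ i, (n i).Partition} {γ : (∑ i, n i).Partition}
    {W : Fin (r + 1 + 1) → Submodule ℂ[X] M} (hW : IsTypedFlag α W)
    (hM : HasType ℂ M γ.toYoungDiagram) :
    ∃ β : ∀ k : Fin (r + 1), (∑ i ∈ Finset.Iic k, n i).Partition,
      (β 0).parts = (α 0).parts ∧ (β (Fin.last r)).parts = γ.parts ∧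
        ∀ k : Fin r, lrCoeff (β k.castSucc) (α k.succ) (β k.succ) ≠ 0 := by
  have hstep : ∀ j : Fin (r + 1),
      finrank ℂ (W j.succ) = finrank ℂ (W j.castSucc) + n j := by
    intro j
    rw [← finrank_quotient_add_finrank_polynomialModule (K := ℂ)
      ((W j.castSucc).submoduleOf (W j.succ)), (hW.hasType j).finrank_eq,
      (α j).card_toYoungDiagram,
      ((Submodule.submoduleOfEquivOfLe (hW.le j)).restrictScalars ℂ).finrank_eq, add_comm]
  have hdim : ∀ k : Fin (r + 1), finrank ℂ (W k.succ) = ∑ i ∈ Finset.Iic k, n i := by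
    intro k
    induction k using Fin.induction with
    | zero =>
      have h0 : (Finset.Iic 0 : Finset (Fin (r + 1))) = {0} := by
        ext i
        simp
      rw [hstep, Fin.castSucc_zero, hW.zero, finrank_polynomialModule_bot, h0,
        Finset.sum_singleton, zero_add]
    | succ k ih =>
      rw [hstep, ← Fin.succ_castSucc, ih, Fin.Iic_succ_eq_insert, Finset.sum_insert, add_comm]
      simp [Fin.le_def]
  have hnil : ∀ (P : Submodule ℂ[X] M) (z : P), ∃ d, (X : ℂ[X]) ^ d • z = 0 := by
    intro P z
    obtain ⟨d, hd⟩ := hM.exists_pow_smul (z : M)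
    exact ⟨d, Subtype.ext hd⟩
  have hex : ∀ k : Fin (r + 1), ∃ p : (∑ i ∈ Finset.Iic k, n i).Partition,
      HasType ℂ (W k.succ) p.toYoungDiagram := by
    intro k
    obtain ⟨μ, hμ⟩ := exists_hasType (K := ℂ) (M := W k.succ) (hnil (W k.succ))
    obtain ⟨p, rfl⟩ := μ.exists_partition (hμ.finrank_eq.symm.trans (hdim k))
    exact ⟨p, hμ⟩
  choose β hβ using hex
  refine ⟨β, ?_, ?_, fun k => ?_⟩
  · have h1 : (W (Fin.castSucc 0)).submoduleOf (W (Fin.succ 0)) = ⊥ := by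
      rw [Fin.castSucc_zero, hW.zero, eq_bot_iff]
      intro z hz
      exact (Submodule.mem_bot ℂ[X]).mpr (Subtype.ext ((Submodule.mem_bot ℂ[X]).mp hz))
    have h2 := (hW.hasType 0).of_equiv (Submodule.quotEquivOfEqBot _ h1)
    rw [Nat.Partition.parts_eq_rowLens, Nat.Partition.parts_eq_rowLens, (hβ 0).unique h2]
  · have h1 : HasType ℂ (W (Fin.last r).succ) γ.toYoungDiagram := by
      rw [Fin.succ_last, hW.last]
      exact hM.of_equiv Submodule.topEquiv.symm
    rw [Nat.Partition.parts_eq_rowLens, Nat.Partition.parts_eq_rowLens,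
      (hβ (Fin.last r)).unique h1]
  · rw [lrCoeff_ne_zero_iff]
    have h1 := hW.hasType k.succ
    have h2 : HasType ℂ (W k.succ.castSucc) (β k.castSucc).toYoungDiagram := hβ k.castSucc
    have h3 : HasType ℂ ((W k.succ.castSucc).submoduleOf (W k.succ.succ)) _ :=
      h2.of_equiv (Submodule.submoduleOfEquivOfLe (hW.le k.succ)).symm
    exact exists_lrChain_of_hasType h3 h1 (hβ k.succ)

/-- A family with nonzero Littlewood-Richardson coefficients is realized by a flag, built from the
top. -/
theorem exists_isTypedFlag {α : ∀ i, (n i).Partition} {γ : (∑ i, n i).Partition}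
    {β : ∀ k : Fin (r + 1), (∑ i ∈ Finset.Iic k, n i).Partition}
    (h0 : (β 0).parts = (α 0).parts) (hlast : (β (Fin.last r)).parts = γ.parts)
    (hβ : ∀ k : Fin r, lrCoeff (β k.castSucc) (α k.succ) (β k.succ) ≠ 0)
    (hM : HasType ℂ M γ.toYoungDiagram) :
    ∃ W : Fin (r + 1 + 1) → Submodule ℂ[X] M, IsTypedFlag α W := by
  have hparts : ∀ {a b : ℕ} {p : a.Partition} {q : b.Partition}, p.parts = q.parts →
      p.toYoungDiagram = q.toYoungDiagram := by
    intro a b p q h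
    refine YoungDiagram.equivListRowLens.injective (Subtype.ext ?_)
    change YoungDiagram.rowLens _ = YoungDiagram.rowLens _
    rw [Nat.Partition.rowLens_toYoungDiagram, Nat.Partition.rowLens_toYoungDiagram, h]
  have key : ∀ k : Fin (r + 1), ∃ V : Fin (r + 1) → Submodule ℂ[X] M, V (Fin.last r) = ⊤ ∧
      (∀ j, k ≤ j → HasType ℂ (V j) (β j).toYoungDiagram) ∧
      ∀ j : Fin r, k ≤ j.castSucc → V j.castSucc ≤ V j.succ ∧
        HasType ℂ (↥(V j.succ) ⧸ (V j.castSucc).submoduleOf (V j.succ))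
          (α j.succ).toYoungDiagram := by
    intro k
    induction k using Fin.reverseInduction with
    | last =>
      refine ⟨fun _ => ⊤, rfl, fun j hj => ?_, fun j hj => ?_⟩
      · obtain rfl := Fin.last_le_iff.mp hj
        rw [hparts hlast]
        exact hM.of_equiv Submodule.topEquiv.symm
      · exact absurd hj (not_le.mpr (Fin.castSucc_lt_last j))
    | cast k ih =>
      obtain ⟨V, hV1, hV2, hV3⟩ := ih
      obtain ⟨l, hl⟩ := (lrCoeff_ne_zero_iff _ _ _).mp (hβ k)
      obtain ⟨N, hN1, hN2⟩ := hl.exists_submodule (hV2 k.succ le_rfl)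
      have hsub : (N.map (V k.succ).subtype).submoduleOf (V k.succ) = N :=
        Submodule.comap_map_eq_of_injective (V k.succ).injective_subtype N
      have hne : ∀ j : Fin (r + 1), k.succ ≤ j → j ≠ k.castSucc := by
        rintro j hj rfl
        simp [Fin.le_def] at hj
      refine ⟨Function.update V k.castSucc (N.map (V k.succ).subtype), ?_, fun j hj => ?_,
        fun j hj => ?_⟩
      · rw [Function.update_of_ne (hne _ (Fin.le_last _)), hV1]
      · rcases eq_or_ne j k.castSucc with rfl | hjk
        · rw [Function.update_self]
          exact hN1.of_equiv (Submodule.equivMapOfInjective _ (V k.succ).injective_subtype N)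
        · rw [Function.update_of_ne hjk]
          refine hV2 j ?_
          rw [Fin.le_def] at hj ⊢
          rw [Ne, Fin.ext_iff] at hjk
          simp only [Fin.val_succ, Fin.val_castSucc] at *
          omega
      · have hjs : k.succ ≤ j.succ := by
          rw [Fin.le_def] at hj ⊢
          simp only [Fin.val_succ, Fin.val_castSucc] at *
          omega
        rw [Function.update_of_ne (hne _ hjs)]
        rcases eq_or_ne j k with rfl | hjk
        · rw [Function.update_self, hsub]
          exact ⟨Submodule.map_subtype_le _ _, hN2⟩
        · rw [Function.update_of_ne (fun h => hjk (Fin.castSucc_injective _ h))]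
          refine hV3 j ?_
          rw [Fin.le_def] at hj ⊢
          rw [Ne, Fin.ext_iff] at hjk
          simp only [Fin.val_succ, Fin.val_castSucc] at *
          omega
  obtain ⟨V, hV1, hV2, hV3⟩ := key 0
  refine ⟨Fin.cons ⊥ V, ?_, ?_, fun j => ?_, fun j => ?_⟩
  · rw [Fin.cons_zero]
  · rw [← Fin.succ_last, Fin.cons_succ, hV1]
  · rw [Fin.cons_succ]
    induction j using Fin.cases with
    | zero => rw [Fin.castSucc_zero, Fin.cons_zero]; exact bot_le
    | succ k =>
      rw [← Fin.succ_castSucc, Fin.cons_succ]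
      exact (hV3 k (Fin.zero_le _)).1
  · rw [Fin.cons_succ]
    induction j using Fin.cases with
    | zero =>
      rw [Fin.castSucc_zero, Fin.cons_zero, ← hparts h0]
      refine (hV2 0 le_rfl).of_equiv (Submodule.quotEquivOfEqBot _ ?_).symm
      rw [eq_bot_iff]
      intro z hz
      exact (Submodule.mem_bot ℂ[X]).mpr (Subtype.ext ((Submodule.mem_bot ℂ[X]).mp hz))
    | succ k =>
      rw [← Fin.succ_castSucc, Fin.cons_succ]
      exact (hV3 k (Fin.zero_le _)).2

end IteratedFlag

theorem corollaryB {r : ℕ} (n : Fin (r + 1) → ℕ) (α : ∀ i, (n i).Partition)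
    (γ : (∑ i, n i).Partition) :
    nilpotentOrbit γ ⊆
        adjointSaturation
          (leviOrbit n α +
            (parabolicNilradical n : Set (Matrix (Fin (∑ i, n i)) (Fin (∑ i, n i)) ℂ))) ↔
      iteratedLR n α γ ≠ 0 := by
  rw [iteratedLR_ne_zero_iff]
  constructor
  · intro h
    obtain ⟨Y, hY⟩ := nilpotentOrbit_nonempty γ
    obtain ⟨W, hW⟩ := (mem_adjointSaturation_leviOrbit_iff α Y).mp (h hY)
    exact hW.exists_partitions ((mem_nilpotentOrbit_iff γ Y).mp hY)
  · rintro ⟨β, h0, hlast, hβ⟩ Y hY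
    exact (mem_adjointSaturation_leviOrbit_iff α Y).mpr
      (exists_isTypedFlag h0 hlast hβ ((mem_nilpotentOrbit_iff γ Y).mp hY))
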